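/- Fix a countably infinite set $\mathsf{Prop}$ of propositional symbols. Formulas of modal logic $\mathcal{ML}$ (classical formulas) are given by $\alpha ::= p\mid\bot\mid\neg\alpha\mid(\alpha\lor\alpha)\mid(\alpha\land\alpha)\mid\Diamond\alpha\mid\Box\alpha$, with $\top:=\neg\bot$. Formulas of modal inclusion logic $\mathcal{ML}(\subseteq)$ are given by $$\phi ::= p\mid\bot\mid(\alpha_1\dots\alpha_n\subseteq\beta_1\dots\beta_n)\mid\neg\alpha\mid(\phi\lor\phi)\mid(\phi\land\phi)\mid\Diamond\phi\mid\Box\phi\qquad(n\ge 1),$$ where $\alpha,\alpha_i,\beta_i$ are classical. Throughout, $\alpha,\beta$ are classical formulas, $\phi,\psi,\chi$ are $\mathcal{ML}(\subseteq)$-formulas, $\mathsf a,\mathsf b,\mathsf c$ are nonempty finite sequences of classical formulas, $x,x_i$ are constants in $\{\top,\bot\}$, and $\mathsf x,\mathsf x_i$ are sequences of such constants (of the same length as the sequence they are paired with). Write $\alpha^\top:=\alpha$, $\alpha^\bot:=\neg\alpha$, and $\mathsf a^{\mathsf x}:=\alpha_1^{x_1}\land\dots\land\alpha_n^{x_n}$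 for $\mathsf a=\alpha_1\dots\alpha_n$, $\mathsf x=x_1\dots x_n$. **Semantics (lax team semantics).** Let $M=(W,R,V)$ be a Kripke model and $T\subseteq W$ a team. Let $R[T]=\{v\mid\exists w\in T\; wRv\}$, and write $TRS$ if $S\subseteq R[T]$ and every $w\in T$ has an $R$-successor in $S$. Then: $T\models p$ iff $T\subseteq V(p)$; $T\models\bot$ iff $T=\emptyset$; $T\models\alpha_1\dots\alpha_n\subseteq\beta_1\dots\beta_n$ iff for every $w\in T$ there is $v\in T$ such that, for all $i$, $\{w\}\models\alpha_i$ iff $\{v\}\models\beta_i$; $T\models\neg\alpha$ iff $\{w\}\not\models\alpha$ for all $w\in T$; $T\models\phi\lor\psi$ iff $T=T_1\cup T_2$ for some $T_1\models\phi$ and $T_2\models\psi$; $T\models\phi\land\psi$ iff $T\models\phi$ and $T\models\psi$; $T\models\Diamond\phi$ iff $S\models\phi$ for some $S$ with $TRS$; $T\models\Box\phi$ iff $R[T]\models\phi$. $\Gamma\models\psi$ means that, for all models $M$ and teams $T$ of $M$, if $T$ satisfies every formula of $\Gamma$ then $T\models\psi$. **Proof system.** $\Gamma\vdash\psi$ means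 that $\psi$ has a natural deduction derivation, all of whose undischarged assumptions are in $\Gamma$, built with the following rules. Here "$[\phi]\Rightarrow\chi$" stands for a subderivation of $\chi$ in which the assumption $\phi$ may be discharged. *Classical modal rules:* - $\neg$I: from $[\alpha]\Rightarrow\bot$ infer $\neg\alpha$; RAA: from $[\neg\alpha]\Rightarrow\bot$ infer $\alpha$; in both, the remaining undischarged assumptions of the subderivation must be $\mathcal{ML}$-formulas. - $\neg$E: from $\alpha$ and $\neg\alpha$ infer $\phi$. - $\lor$I: from $\phi$, or from $\psi$, infer $\phi\lor\psi$. - $\lor$E: from $\phi\lor\psi$, $[\phi]\Rightarrow\chi$ and $[\psi]\Rightarrow\chi$ infer $\chi$, provided that the remaining undischarged assumptions of the two subderivations are $\mathcal{ML}$-formulas. - $\land$I: from $\phi$ and $\psi$ infer $\phi\land\psi$; $\land$E: from $\phi\land\psi$ infer $\phi$, and infer $\psi$. - From $\neg\Box\alpha$ infer $\Diamond\neg\alpha$, and conversely; from $\Diamond(\phi\lor\psi)$ infer $\Diamond\phi\lor\Diamond\psi$. - $\Box$Mon ($n\ge 0$): from $\Box\phi_1,\dots,\Box\phi_n$ and $[\phi_1],\dots,[\phi_n]\Rightarrow\psi$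 infer $\Box\psi$; $\Diamond$Mon: from $\Diamond\phi$ and $[\phi]\Rightarrow\psi$ infer $\Diamond\psi$; in both, the subderivation has no other undischarged assumptions. *Inclusion rules:* - $\subseteq$Id: infer $\mathsf a\subseteq\mathsf a$. - $\subseteq$Exp: from $\alpha^x$ and $\mathsf b\subseteq\mathsf c$ infer $x\mathsf b\subseteq\alpha\mathsf c$. - $\subseteq_\neg$E: from $\neg\mathsf a^{\mathsf x}$ and $\mathsf x\subseteq\mathsf a$ infer $\phi$. - $\lor_\subseteq$E: from $(\mathsf x\subseteq\mathsf a)\lor\psi$, $[\mathsf x\subseteq\mathsf a]\Rightarrow\chi$ and $[\psi]\Rightarrow\chi$ infer $\chi$. - $\subseteq$Ext: from $\bigwedge_{\mathsf x\in\{\top,\bot\}^{|\mathsf a|}}(\neg\mathsf a^{\mathsf x}\lor(\mathsf x\subseteq\mathsf b))$ infer $\mathsf a\subseteq\mathsf b$. - $\subseteq$Rdt: from $\mathsf a\subseteq\mathsf b$ infer $\neg\mathsf a^{\mathsf x}\lor(\mathsf x\subseteq\mathsf b)$. - $\subseteq$Distr: from $\phi\lor\psi$ and $\mathsf x_1\subseteq\mathsf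 a_1,\dots,\mathsf x_n\subseteq\mathsf a_n$ infer $\big((\phi\lor\mathsf a_1^{\mathsf x_1}\lor\dots\lor\mathsf a_n^{\mathsf x_n})\land(\mathsf x_1\subseteq\mathsf a_1)\land\dots\land(\mathsf x_n\subseteq\mathsf a_n)\big)\lor\psi$. *Rules for modalities and inclusion:* - $\Diamond_\subseteq$Distr: from $\Diamond(\mathsf x\subseteq\mathsf a)$ infer $\top\subseteq\Diamond\mathsf a^{\mathsf x}$. - $\Diamond\Box_\subseteq$Exc: from $\top\subseteq\Diamond\mathsf a^{\mathsf x}$ infer $\Box(\mathsf x\subseteq\mathsf a)$. - $\Box\Diamond_\subseteq$Exc: from $\top\subseteq\Diamond\beta$ and $\Box(\mathsf x\subseteq\mathsf a)$ infer $\top\subseteq\Diamond\mathsf a^{\mathsf x}$. - $\Box\lor_\subseteq$E: from $\Box((\mathsf x\subseteq\mathsf a)\lor\psi)$, $[\top\subseteq\Diamond\mathsf a^{\mathsf x}]\Rightarrow\chi$ and $[\Box\psi]\Rightarrow\chi$ infer $\chi$. - $\subseteq_\Diamond$Distr: from $\Diamond\phi$ and $x_1\subseteq\Diamond\alpha_1,\dots,x_n\subseteq\Diamond\alpha_n$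 infer $\Diamond\big((\phi\lor\alpha_1^{x_1}\lor\dots\lor\alpha_n^{x_n})\land(x_1\subseteq\alpha_1)\land\dots\land(x_n\subseteq\alpha_n)\big)$. **Theorem.** For every (possibly infinite) set $\Gamma$ of $\mathcal{ML}(\subseteq)$-formulas and every $\mathcal{ML}(\subseteq)$-formula $\psi$: if $\Gamma\models\psi$ then $\Gamma\vdash\psi$ (completeness), and if $\Gamma\vdash\psi$ then $\Gamma\models\psi$ (soundness). -/

import Mathlib

universe v

/-- Formulas of the usual modal logic `ML` over propositional symbols `P` ("classical formulas"). -/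
inductive ML (P : Type) : Type
  | var : P → ML P
  | bot : ML P
  | neg : ML P → ML P
  | or : ML P → ML P → ML P
  | and : ML P → ML P → ML P
  | dia : ML P → ML P
  | box : ML P → ML P

/-- Formulas of modal inclusion logic `ML(⊆)`. Negation is applied to classical formulas only, and
`incl n a b` is the inclusion atom `a₀ … aₙ ⊆ b₀ … bₙ` of arity `n + 1` between sequences of
classical formulas. -/
inductive MLI (P : Type) : Type
  | var : P → MLI P
  | bot : MLI P
  | incl (n : ℕ) (a b : Fin (n + 1) → ML P) : MLI P
  | neg : ML P → MLI P
  | or : MLI P → MLI P → MLI P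
  | and : MLI P → MLI P → MLI P
  | dia : MLI P → MLI P
  | box : MLI P → MLI P

namespace ML

variable {P : Type}

/-- `⊤ := ¬⊥`. -/
def top : ML P := neg bot

/-- The constant `⊤` or `⊥` given by a Boolean. -/
def const : Bool → ML P
  | true => top
  | false => bot

/-- `α^⊤ = α` and `α^⊥ = ¬α`. -/
def lit (α : ML P) : Bool → ML P
  | true => α
  | false => neg α

/-- The conjunction `α₀ ∧ (α₁ ∧ (… ∧ αₙ))` of a nonempty sequence. -/
def conj : {n : ℕ} → (Fin (n + 1) → ML P) → ML P
  | 0, a => a 0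
  | _ + 1, a => and (a 0) (conj fun i => a i.succ)

/-- `a^x = a₀^{x₀} ∧ … ∧ aₙ^{xₙ}`. -/
def pow {n : ℕ} (a : Fin (n + 1) → ML P) (x : Fin (n + 1) → Bool) : ML P :=
  conj fun i => (a i).lit (x i)

end ML

namespace MLI

variable {P : Type}

/-- The inclusion of the formulas of `ML` among the formulas of `ML(⊆)`. -/
def ofML : ML P → MLI P
  | .var p => var p
  | .bot => bot
  | .neg α => neg α
  | .or α β => or (ofML α) (ofML β)
  | .and α β => and (ofML α) (ofML β)
  | .dia α => dia (ofML α)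
  | .box α => box (ofML α)

/-- `φ` is a formula of `ML`. -/
def IsClassical (φ : MLI P) : Prop := ∃ α : ML P, ofML α = φ

/-- The `ML`-formulas belonging to `Γ`. -/
def classicalPart (Γ : Set (MLI P)) : Set (MLI P) := {γ | γ ∈ Γ ∧ γ.IsClassical}

/-- The primitive inclusion atom `x ⊆ a`, where `x` is a sequence of constants `⊤`, `⊥`. -/
def prim {n : ℕ} (x : Fin (n + 1) → Bool) (a : Fin (n + 1) → ML P) : MLI P :=
  incl n (fun i => ML.const (x i)) a

/-- The unary primitive inclusion atom `x ⊆ α`. -/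
def prim₁ (x : Bool) (α : ML P) : MLI P := incl 0 (fun _ => ML.const x) (fun _ => α)

/-- `⋀_{x ∈ {⊤,⊥}^n} f x`. -/
def cubeConj : (n : ℕ) → ((Fin n → Bool) → MLI P) → MLI P
  | 0, f => f Fin.elim0
  | n + 1, f =>
      and (cubeConj n fun x => f (Fin.cons true x)) (cubeConj n fun x => f (Fin.cons false x))

/-- `φ ∨ ψ₁ ∨ … ∨ ψₖ`, associated to the left. -/
def orAll (φ : MLI P) (l : List (MLI P)) : MLI P := l.foldl or φ

/-- `φ ∧ ψ₁ ∧ … ∧ ψₖ`, associated to the left. -/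
def andAll (φ : MLI P) (l : List (MLI P)) : MLI P := l.foldl and φ

end MLI

/-! ### Team semantics -/

/-- A Kripke model; `V p` is the set of worlds at which `p` is true. -/
structure KripkeModel (P : Type) : Type (v + 1) where
  W : Type v
  R : W → W → Prop
  V : P → Set W

namespace KripkeModel

variable {P : Type}

/-- `R[T]`. -/
def image (M : KripkeModel.{v} P) (T : Set M.W) : Set M.W := {u | ∃ w ∈ T, M.R w u}

/-- `R⁻¹[T]`. -/
def preimage (M : KripkeModel.{v} P) (T : Set M.W) : Set M.W := {w | ∃ u ∈ T, M.R w u}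

/-- `TRS`: `S` is a successor team of `T`. -/
def SuccTeam (M : KripkeModel.{v} P) (T S : Set M.W) : Prop :=
  S ⊆ M.image T ∧ T ⊆ M.preimage S

end KripkeModel

/-- Team satisfaction `M, T ⊨ α` for classical formulas. -/
def ML.Sat {P : Type} (M : KripkeModel.{v} P) : Set M.W → ML P → Prop
  | T, .var p => T ⊆ M.V p
  | T, .bot => T = ∅
  | T, .neg α => ∀ w ∈ T, ¬ ML.Sat M {w} α
  | T, .or α β => ∃ T₁ T₂ : Set M.W, T₁ ∪ T₂ = T ∧ ML.Sat M T₁ α ∧ ML.Sat M T₂ β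
  | T, .and α β => ML.Sat M T α ∧ ML.Sat M T β
  | T, .dia α => ∃ S : Set M.W, M.SuccTeam T S ∧ ML.Sat M S α
  | T, .box α => ML.Sat M (M.image T) α

/-- Team satisfaction `M, T ⊨ φ` (lax semantics) for formulas of `ML(⊆)`. -/
def MLI.Sat {P : Type} (M : KripkeModel.{v} P) : Set M.W → MLI P → Prop
  | T, .var p => T ⊆ M.V p
  | T, .bot => T = ∅
  | T, .incl _ a b => ∀ w ∈ T, ∃ u ∈ T, ∀ i, ML.Sat M {w} (a i) ↔ ML.Sat M {u} (b i)
  | T, .neg α => ∀ w ∈ T, ¬ ML.Sat M {w} α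
  | T, .or φ ψ => ∃ T₁ T₂ : Set M.W, T₁ ∪ T₂ = T ∧ MLI.Sat M T₁ φ ∧ MLI.Sat M T₂ ψ
  | T, .and φ ψ => MLI.Sat M T φ ∧ MLI.Sat M T ψ
  | T, .dia φ => ∃ S : Set M.W, M.SuccTeam T S ∧ MLI.Sat M S φ
  | T, .box φ => MLI.Sat M (M.image T) φ

/-- The two satisfaction relations agree on classical formulas, so that there is really a single
satisfaction relation, the one of `ML(⊆)`. -/
theorem MLI.sat_ofML {P : Type} (M : KripkeModel.{v} P) (T : Set M.W) (α : ML P) :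
    MLI.Sat M T (MLI.ofML α) ↔ ML.Sat M T α := by
  induction α generalizing T with
  | var p => rfl
  | bot => rfl
  | neg α _ => rfl
  | or α β iα iβ => simp only [MLI.ofML, MLI.Sat, ML.Sat, iα, iβ]
  | and α β iα iβ => simp only [MLI.ofML, MLI.Sat, ML.Sat, iα, iβ]
  | dia α iα => simp only [MLI.ofML, MLI.Sat, ML.Sat, iα]
  | box α iα => simp only [MLI.ofML, MLI.Sat, ML.Sat, iα]

/-- `Γ ⊨ φ`: every team of every model that satisfies all formulas of `Γ` satisfies `φ`. -/
def MLI.Entails {P : Type} (Γ : Set (MLI P)) (φ : MLI P) : Prop :=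
  ∀ (M : KripkeModel.{v} P) (T : Set M.W), (∀ γ ∈ Γ, MLI.Sat M T γ) → MLI.Sat M T φ

/-! ### The natural deduction system -/

/-- A primitive inclusion atom `x ⊆ a` of arbitrary positive arity, as a pair of sequences. -/
structure PrimAtom (P : Type) : Type where
  n : ℕ
  x : Fin (n + 1) → Bool
  a : Fin (n + 1) → ML P

/-- The atom `x ⊆ a` as a formula. -/
def PrimAtom.toMLI {P : Type} (A : PrimAtom P) : MLI P := MLI.prim A.x A.a

/-- The formula `a^x` belonging to the atom `x ⊆ a`. -/
def PrimAtom.pow {P : Type} (A : PrimAtom P) : MLI P := MLI.ofML (ML.pow A.a A.x)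

open MLI in
/-- `Derivable Γ φ`, i.e. `Γ ⊢ φ`: there is a natural deduction derivation of `φ` all of whose
undischarged assumptions belong to `Γ`. A subderivation in which `φ` is discharged has its
assumptions in `insert φ Γ`; in the rules that require the remaining undischarged assumptions of
a subderivation to be `ML`-formulas, `Γ` is replaced there by `classicalPart Γ`, and in the two
monotonicity rules for the modalities nothing besides the discharged formulas is available. -/
inductive Derivable {P : Type} : Set (MLI P) → MLI P → Prop
  | assumption {Γ : Set (MLI P)} {φ : MLI P} : φ ∈ Γ → Derivable Γ φ
  -- rules for classical modal logic
  | negI {Γ : Set (MLI P)} {α : ML P} :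
      Derivable (insert (ofML α) (classicalPart Γ)) bot → Derivable Γ (neg α)
  | raa {Γ : Set (MLI P)} {α : ML P} :
      Derivable (insert (neg α) (classicalPart Γ)) bot → Derivable Γ (ofML α)
  | negE {Γ : Set (MLI P)} {α : ML P} {φ : MLI P} :
      Derivable Γ (ofML α) → Derivable Γ (neg α) → Derivable Γ φ
  | orIl {Γ : Set (MLI P)} {φ ψ : MLI P} : Derivable Γ φ → Derivable Γ (or φ ψ)
  | orIr {Γ : Set (MLI P)} {φ ψ : MLI P} : Derivable Γ ψ → Derivable Γ (or φ ψ)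
  | orE {Γ : Set (MLI P)} {φ ψ χ : MLI P} : Derivable Γ (or φ ψ) →
      Derivable (insert φ (classicalPart Γ)) χ → Derivable (insert ψ (classicalPart Γ)) χ →
      Derivable Γ χ
  | andI {Γ : Set (MLI P)} {φ ψ : MLI P} :
      Derivable Γ φ → Derivable Γ ψ → Derivable Γ (and φ ψ)
  | andEl {Γ : Set (MLI P)} {φ ψ : MLI P} : Derivable Γ (and φ ψ) → Derivable Γ φ
  | andEr {Γ : Set (MLI P)} {φ ψ : MLI P} : Derivable Γ (and φ ψ) → Derivable Γ ψ
  | diaBoxInter {Γ : Set (MLI P)} {α : ML P} :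
      Derivable Γ (neg (.box α)) → Derivable Γ (dia (neg α))
  | boxDiaInter {Γ : Set (MLI P)} {α : ML P} :
      Derivable Γ (dia (neg α)) → Derivable Γ (neg (.box α))
  | diaOrDistr {Γ : Set (MLI P)} {φ ψ : MLI P} :
      Derivable Γ (dia (or φ ψ)) → Derivable Γ (or (dia φ) (dia ψ))
  | boxMon {Γ : Set (MLI P)} {l : List (MLI P)} {ψ : MLI P} :
      Derivable {φ | φ ∈ l} ψ → (∀ φ ∈ l, Derivable Γ (box φ)) → Derivable Γ (box ψ)
  | diaMon {Γ : Set (MLI P)} {φ ψ : MLI P} :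
      Derivable {φ} ψ → Derivable Γ (dia φ) → Derivable Γ (dia ψ)
  -- rules for inclusion
  | inclId {Γ : Set (MLI P)} {n : ℕ} {a : Fin (n + 1) → ML P} : Derivable Γ (incl n a a)
  | inclExp {Γ : Set (MLI P)} {n : ℕ} {α : ML P} {x : Bool} {b c : Fin (n + 1) → ML P} :
      Derivable Γ (ofML (α.lit x)) → Derivable Γ (incl n b c) →
      Derivable Γ (incl (n + 1) (Fin.cons (ML.const x) b) (Fin.cons α c))
  | inclNegE {Γ : Set (MLI P)} {n : ℕ} {x : Fin (n + 1) → Bool} {a : Fin (n + 1) → ML P}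
      {φ : MLI P} :
      Derivable Γ (neg (ML.pow a x)) → Derivable Γ (prim x a) → Derivable Γ φ
  | orInclE {Γ : Set (MLI P)} {n : ℕ} {x : Fin (n + 1) → Bool} {a : Fin (n + 1) → ML P}
      {ψ χ : MLI P} : Derivable Γ (or (prim x a) ψ) →
      Derivable (insert (prim x a) Γ) χ → Derivable (insert ψ Γ) χ → Derivable Γ χ
  | inclExt {Γ : Set (MLI P)} {n : ℕ} {a b : Fin (n + 1) → ML P} :
      Derivable Γ (cubeConj (n + 1) fun x => or (neg (ML.pow a x)) (prim x b)) →
      Derivable Γ (incl n a b)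
  | inclRdt {Γ : Set (MLI P)} {n : ℕ} {a b : Fin (n + 1) → ML P} {x : Fin (n + 1) → Bool} :
      Derivable Γ (incl n a b) → Derivable Γ (or (neg (ML.pow a x)) (prim x b))
  | inclDistr {Γ : Set (MLI P)} {φ ψ : MLI P} {l : List (PrimAtom P)} :
      Derivable Γ (or φ ψ) → (∀ A ∈ l, Derivable Γ A.toMLI) →
      Derivable Γ (or (andAll (orAll φ (l.map PrimAtom.pow)) (l.map PrimAtom.toMLI)) ψ)
  -- rules for modal operators and inclusion
  | diaInclDistr {Γ : Set (MLI P)} {n : ℕ} {x : Fin (n + 1) → Bool} {a : Fin (n + 1) → ML P} :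
      Derivable Γ (dia (prim x a)) → Derivable Γ (prim₁ true (.dia (ML.pow a x)))
  | diaBoxInclExc {Γ : Set (MLI P)} {n : ℕ} {x : Fin (n + 1) → Bool} {a : Fin (n + 1) → ML P} :
      Derivable Γ (prim₁ true (.dia (ML.pow a x))) → Derivable Γ (box (prim x a))
  | boxDiaInclExc {Γ : Set (MLI P)} {n : ℕ} {x : Fin (n + 1) → Bool} {a : Fin (n + 1) → ML P}
      {β : ML P} : Derivable Γ (prim₁ true (.dia β)) → Derivable Γ (box (prim x a)) →
      Derivable Γ (prim₁ true (.dia (ML.pow a x)))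
  | boxOrInclE {Γ : Set (MLI P)} {n : ℕ} {x : Fin (n + 1) → Bool} {a : Fin (n + 1) → ML P}
      {ψ χ : MLI P} : Derivable Γ (box (or (prim x a) ψ)) →
      Derivable (insert (prim₁ true (.dia (ML.pow a x))) Γ) χ →
      Derivable (insert (box ψ) Γ) χ → Derivable Γ χ
  | inclDiaDistr {Γ : Set (MLI P)} {φ : MLI P} {l : List (Bool × ML P)} :
      Derivable Γ (dia φ) → (∀ A ∈ l, Derivable Γ (prim₁ A.1 (.dia A.2))) →
      Derivable Γ (dia (andAll (orAll φ (l.map fun A => ofML (A.2.lit A.1)))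
        (l.map fun A => prim₁ A.1 A.2)))

/-!
Soundness is an induction on derivations (`Derivable.sound`). It rests on three facts about teams:
the empty team satisfies every formula, the union of two teams satisfying a formula satisfies it,
and a classical formula is true in a team iff it is true at each world.

Completeness is proved with the canonical model of classical modal logic, whose worlds are the
complete consistent sets of classical formulas. Two constructions relate formulas and teams of this
model.

* To a set `Δ` of formulas belongs the team `teamOf Δ` of all worlds containing the classical
  consequences of `Δ`. It satisfies every consequence of `Δ`, classical or not (`sat_teamOf`).
* To a team `T` belongs its diagram, which says which classical formulas are true throughout `T` and,
  by atoms `⊤ ⊆ α`, which are true somewhere in `T`. The diagram derives every formula that `T`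
  satisfies (`derivable_diagram_of_sat`). As a derivation uses finitely many assumptions, the rules
  `⊆Distr` and `⊆_◇Distr` turn a splitting of `T`, or a successor team of `T`, into a derivation of
  the disjunction or the diamond formula.

The link is the disjunction `(x ⊆ a) ∨ ¬a^x`, which is derivable outright, together with the rule
`∨_⊆E`, which eliminates it in the presence of arbitrary side assumptions. Call a deductively closed
set prime if it decides the disjunctions whose left disjunct is an atom `x ⊆ a`. A prime set contains
`⊤ ⊆ α` or `¬α` for each classical `α`, hence derives the diagram of its own team
(`IsPrimeTheory.derivable_of_mem_diagram`). Now if `Γ ⊬ ψ`, then `Γ` extends to a prime set `Δ` with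
`Δ ⊬ ψ` (`exists_isPrimeTheory`). The team of `Δ` satisfies `Γ`. If it satisfied `ψ`, its diagram would
derive `ψ`, and then so would `Δ`.

The rules `∨E`, `¬I` and RAA admit only classical side assumptions, so that cut (`Derivable.cut`) is
not plain substitution: the same disjunction takes care of classical cut formulas that are derived
from nonclassical assumptions.
-/

/-! ### Structural properties of derivations -/

namespace MLI

variable {P : Type}

theorem isClassical_ofML (α : ML P) : (ofML α).IsClassical := ⟨α, rfl⟩

theorem classicalPart_subset (Γ : Set (MLI P)) : classicalPart Γ ⊆ Γ := fun _ h => h.1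

theorem classicalPart_mono {Γ Δ : Set (MLI P)} (h : Γ ⊆ Δ) :
    classicalPart Γ ⊆ classicalPart Δ := fun _ hγ => ⟨h hγ.1, hγ.2⟩

theorem classicalPart_image (X : Set (ML P)) : classicalPart (ofML '' X) = ofML '' X := by
  refine (classicalPart_subset _).antisymm ?_
  rintro _ ⟨α, hα, rfl⟩
  exact ⟨⟨α, hα, rfl⟩, isClassical_ofML α⟩

end MLI

namespace Derivable

open MLI

variable {P : Type} {Γ Δ : Set (MLI P)} {φ φ' ψ χ : MLI P} {α β : ML P}

theorem mono (h : Derivable Γ φ) (hs : Γ ⊆ Δ) : Derivable Δ φ := by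
  induction h generalizing Δ with
  | assumption hm => exact .assumption (hs hm)
  | negI _ ih => exact .negI (ih (Set.insert_subset_insert (classicalPart_mono hs)))
  | raa _ ih => exact .raa (ih (Set.insert_subset_insert (classicalPart_mono hs)))
  | negE _ _ i₁ i₂ => exact .negE (i₁ hs) (i₂ hs)
  | orIl _ ih => exact .orIl (ih hs)
  | orIr _ ih => exact .orIr (ih hs)
  | orE _ _ _ i i₁ i₂ =>
    exact .orE (i hs) (i₁ (Set.insert_subset_insert (classicalPart_mono hs)))
      (i₂ (Set.insert_subset_insert (classicalPart_mono hs)))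
  | andI _ _ i₁ i₂ => exact .andI (i₁ hs) (i₂ hs)
  | andEl _ ih => exact .andEl (ih hs)
  | andEr _ ih => exact .andEr (ih hs)
  | diaBoxInter _ ih => exact .diaBoxInter (ih hs)
  | boxDiaInter _ ih => exact .boxDiaInter (ih hs)
  | diaOrDistr _ ih => exact .diaOrDistr (ih hs)
  | boxMon h _ _ ih => exact .boxMon h fun φ hφ => ih φ hφ hs
  | diaMon h _ _ ih => exact .diaMon h (ih hs)
  | inclId => exact .inclId
  | inclExp _ _ i₁ i₂ => exact .inclExp (i₁ hs) (i₂ hs)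
  | inclNegE _ _ i₁ i₂ => exact .inclNegE (i₁ hs) (i₂ hs)
  | orInclE _ _ _ i i₁ i₂ =>
    exact .orInclE (i hs) (i₁ (Set.insert_subset_insert hs)) (i₂ (Set.insert_subset_insert hs))
  | inclExt _ ih => exact .inclExt (ih hs)
  | inclRdt _ ih => exact .inclRdt (ih hs)
  | inclDistr _ _ ih ih' => exact .inclDistr (ih hs) fun A hA => ih' A hA hs
  | diaInclDistr _ ih => exact .diaInclDistr (ih hs)
  | diaBoxInclExc _ ih => exact .diaBoxInclExc (ih hs)
  | boxDiaInclExc _ _ i₁ i₂ => exact .boxDiaInclExc (i₁ hs) (i₂ hs)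
  | boxOrInclE _ _ _ i i₁ i₂ =>
    exact .boxOrInclE (i hs) (i₁ (Set.insert_subset_insert hs)) (i₂ (Set.insert_subset_insert hs))
  | inclDiaDistr _ _ ih ih' => exact .inclDiaDistr (ih hs) fun A hA => ih' A hA hs

theorem weaken (h : Derivable Γ φ) : Derivable (insert ψ Γ) φ := h.mono (Set.subset_insert _ _)

theorem hyp : Derivable (insert φ Γ) φ := .assumption (Set.mem_insert _ _)

theorem of_singleton (h : Derivable {φ} ψ) : Derivable (insert φ Γ) ψ :=
  h.mono (Set.singleton_subset_iff.2 (Set.mem_insert _ _))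

/-- Replacing assumptions by derivations of them. Classical assumptions are kept, because they may
be used inside a subderivation that admits only classical side assumptions, where a derivation of
them from nonclassical assumptions would violate the side condition. -/
theorem subst (h : Derivable Γ φ) (hd : ∀ γ ∈ Γ, Derivable Δ γ)
    (hc : ∀ γ ∈ Γ, γ.IsClassical → γ ∈ Δ) : Derivable Δ φ := by
  have hcp : ∀ {Γ Δ : Set (MLI P)}, (∀ γ ∈ Γ, γ.IsClassical → γ ∈ Δ) →
      classicalPart Γ ⊆ classicalPart Δ := fun hc γ hγ => ⟨hc γ hγ.1 hγ.2, hγ.2⟩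
  have hdi : ∀ {Γ Δ : Set (MLI P)} {φ : MLI P}, (∀ γ ∈ Γ, Derivable Δ γ) →
      ∀ γ ∈ insert φ Γ, Derivable (insert φ Δ) γ := by
    rintro Γ Δ φ hd γ (rfl | hγ)
    exacts [hyp, (hd γ hγ).weaken]
  have hci : ∀ {Γ Δ : Set (MLI P)} {φ : MLI P}, (∀ γ ∈ Γ, γ.IsClassical → γ ∈ Δ) →
      ∀ γ ∈ insert φ Γ, γ.IsClassical → γ ∈ insert φ Δ := by
    rintro Γ Δ φ hc γ (rfl | hγ) h
    exacts [Set.mem_insert _ _, Set.mem_insert_of_mem _ (hc γ hγ h)]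
  induction h generalizing Δ with
  | assumption hm => exact hd _ hm
  | negI h _ => exact .negI (h.mono (Set.insert_subset_insert (hcp hc)))
  | raa h _ => exact .raa (h.mono (Set.insert_subset_insert (hcp hc)))
  | negE _ _ i₁ i₂ => exact .negE (i₁ hd hc) (i₂ hd hc)
  | orIl _ ih => exact .orIl (ih hd hc)
  | orIr _ ih => exact .orIr (ih hd hc)
  | orE _ h₁ h₂ i _ _ =>
    exact .orE (i hd hc) (h₁.mono (Set.insert_subset_insert (hcp hc)))
      (h₂.mono (Set.insert_subset_insert (hcp hc)))
  | andI _ _ i₁ i₂ => exact .andI (i₁ hd hc) (i₂ hd hc)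
  | andEl _ ih => exact .andEl (ih hd hc)
  | andEr _ ih => exact .andEr (ih hd hc)
  | diaBoxInter _ ih => exact .diaBoxInter (ih hd hc)
  | boxDiaInter _ ih => exact .boxDiaInter (ih hd hc)
  | diaOrDistr _ ih => exact .diaOrDistr (ih hd hc)
  | boxMon h _ _ ih => exact .boxMon h fun φ hφ => ih φ hφ hd hc
  | diaMon h _ _ ih => exact .diaMon h (ih hd hc)
  | inclId => exact .inclId
  | inclExp _ _ i₁ i₂ => exact .inclExp (i₁ hd hc) (i₂ hd hc)
  | inclNegE _ _ i₁ i₂ => exact .inclNegE (i₁ hd hc) (i₂ hd hc)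
  | orInclE _ _ _ i i₁ i₂ =>
    exact .orInclE (i hd hc) (i₁ (hdi hd) (hci hc)) (i₂ (hdi hd) (hci hc))
  | inclExt _ ih => exact .inclExt (ih hd hc)
  | inclRdt _ ih => exact .inclRdt (ih hd hc)
  | inclDistr _ _ ih ih' => exact .inclDistr (ih hd hc) fun A hA => ih' A hA hd hc
  | diaInclDistr _ ih => exact .diaInclDistr (ih hd hc)
  | diaBoxInclExc _ ih => exact .diaBoxInclExc (ih hd hc)
  | boxDiaInclExc _ _ i₁ i₂ => exact .boxDiaInclExc (i₁ hd hc) (i₂ hd hc)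
  | boxOrInclE _ _ _ i i₁ i₂ =>
    exact .boxOrInclE (i hd hc) (i₁ (hdi hd) (hci hc)) (i₂ (hdi hd) (hci hc))
  | inclDiaDistr _ _ ih ih' => exact .inclDiaDistr (ih hd hc) fun A hA => ih' A hA hd hc

/-- A derivation uses only finitely many of its assumptions. -/
theorem exists_finite (h : Derivable Γ φ) : ∃ F ⊆ Γ, F.Finite ∧ Derivable F φ := by
  have one : ∀ {Γ : Set (MLI P)} {φ ψ : MLI P}, (∃ F ⊆ Γ, F.Finite ∧ Derivable F φ) →
      (∀ {F : Set (MLI P)}, Derivable F φ → Derivable F ψ) →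
      ∃ F ⊆ Γ, F.Finite ∧ Derivable F ψ := by
    rintro Γ φ ψ ⟨F, hF, hfin, hd⟩ h
    exact ⟨F, hF, hfin, h hd⟩
  have two : ∀ {Γ : Set (MLI P)} {φ ψ χ : MLI P}, (∃ F ⊆ Γ, F.Finite ∧ Derivable F φ) →
      (∃ F ⊆ Γ, F.Finite ∧ Derivable F ψ) →
      (∀ {F : Set (MLI P)}, Derivable F φ → Derivable F ψ → Derivable F χ) →
      ∃ F ⊆ Γ, F.Finite ∧ Derivable F χ := by
    rintro Γ φ ψ χ ⟨F, hF, hfin, hd⟩ ⟨G, hG, gfin, gd⟩ h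
    exact ⟨F ∪ G, Set.union_subset hF hG, hfin.union gfin,
      h (hd.mono Set.subset_union_left) (gd.mono Set.subset_union_right)⟩
  have many : ∀ {ι : Type} {Γ : Set (MLI P)} {f : ι → MLI P} {l : List ι},
      (∀ i ∈ l, ∃ F ⊆ Γ, F.Finite ∧ Derivable F (f i)) →
      ∃ F ⊆ Γ, F.Finite ∧ ∀ i ∈ l, Derivable F (f i) := by
    intro ι Γ f l
    induction l with
    | nil => exact fun _ => ⟨∅, Set.empty_subset _, Set.finite_empty, by simp⟩
    | cons i l ih =>
      intro h
      obtain ⟨F, hF, hfin, hd⟩ := h i (by simp)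
      obtain ⟨G, hG, gfin, gd⟩ := ih fun j hj => h j (by simp [hj])
      refine ⟨F ∪ G, Set.union_subset hF hG, hfin.union gfin, fun j hj => ?_⟩
      rcases List.mem_cons.1 hj with rfl | hj
      exacts [hd.mono Set.subset_union_left, (gd j hj).mono Set.subset_union_right]
  have discharge : ∀ {Γ : Set (MLI P)} {φ χ : MLI P},
      (∃ F ⊆ insert φ Γ, F.Finite ∧ Derivable F χ) →
      ∃ F ⊆ Γ, F.Finite ∧ Derivable (insert φ F) χ := by
    rintro Γ φ χ ⟨F, hF, hfin, hd⟩
    refine ⟨F \ {φ}, fun γ hγ => (hF hγ.1).resolve_left hγ.2, hfin.sdiff, ?_⟩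
    exact hd.mono fun γ hγ => (em (γ = φ)).imp id fun h => ⟨hγ, h⟩
  have self : ∀ {Γ F : Set (MLI P)}, F ⊆ classicalPart Γ → F ⊆ classicalPart F :=
    fun hF γ hγ => ⟨hγ, (hF hγ).2⟩
  induction h with
  | assumption hm =>
    exact ⟨_, Set.singleton_subset_iff.2 hm, Set.finite_singleton _, .assumption rfl⟩
  | negI _ ih =>
    obtain ⟨F, hF, hfin, hd⟩ := discharge ih
    exact ⟨F, fun γ hγ => (hF hγ).1, hfin, .negI (hd.mono (Set.insert_subset_insert (self hF)))⟩
  | raa _ ih =>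
    obtain ⟨F, hF, hfin, hd⟩ := discharge ih
    exact ⟨F, fun γ hγ => (hF hγ).1, hfin, .raa (hd.mono (Set.insert_subset_insert (self hF)))⟩
  | negE _ _ i₁ i₂ => exact two i₁ i₂ .negE
  | orIl _ ih => exact one ih .orIl
  | orIr _ ih => exact one ih .orIr
  | orE _ _ _ i i₁ i₂ =>
    obtain ⟨E, hE, efin, ed⟩ := i
    obtain ⟨F, hF, hfin, hd⟩ := discharge i₁
    obtain ⟨G, hG, gfin, gd⟩ := discharge i₂
    refine ⟨E ∪ (F ∪ G), Set.union_subset hE (Set.union_subset (fun γ hγ => (hF hγ).1)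
      (fun γ hγ => (hG hγ).1)), efin.union (hfin.union gfin),
      .orE (ed.mono Set.subset_union_left) (hd.mono (Set.insert_subset_insert ?_))
        (gd.mono (Set.insert_subset_insert ?_))⟩
    · exact fun γ hγ => ⟨.inr (.inl hγ), (hF hγ).2⟩
    · exact fun γ hγ => ⟨.inr (.inr hγ), (hG hγ).2⟩
  | andI _ _ i₁ i₂ => exact two i₁ i₂ .andI
  | andEl _ ih => exact one ih .andEl
  | andEr _ ih => exact one ih .andEr
  | diaBoxInter _ ih => exact one ih .diaBoxInter
  | boxDiaInter _ ih => exact one ih .boxDiaInter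
  | diaOrDistr _ ih => exact one ih .diaOrDistr
  | boxMon h _ _ ih =>
    obtain ⟨F, hF, hfin, hd⟩ := many ih
    exact ⟨F, hF, hfin, .boxMon h hd⟩
  | diaMon h _ _ ih => exact one ih (.diaMon h)
  | inclId => exact ⟨∅, Set.empty_subset _, Set.finite_empty, .inclId⟩
  | inclExp _ _ i₁ i₂ => exact two i₁ i₂ .inclExp
  | inclNegE _ _ i₁ i₂ => exact two i₁ i₂ .inclNegE
  | orInclE _ _ _ i i₁ i₂ =>
    obtain ⟨E, hE, efin, ed⟩ := i
    obtain ⟨F, hF, hfin, hd⟩ := discharge i₁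
    obtain ⟨G, hG, gfin, gd⟩ := discharge i₂
    refine ⟨E ∪ (F ∪ G), Set.union_subset hE (Set.union_subset hF hG),
      efin.union (hfin.union gfin),
      .orInclE (ed.mono Set.subset_union_left) (hd.mono (Set.insert_subset_insert ?_))
        (gd.mono (Set.insert_subset_insert ?_))⟩
    · exact fun γ hγ => .inr (.inl hγ)
    · exact fun γ hγ => .inr (.inr hγ)
  | inclExt _ ih => exact one ih .inclExt
  | inclRdt _ ih => exact one ih .inclRdt
  | inclDistr _ _ ih ih' =>
    obtain ⟨E, hE, efin, ed⟩ := ih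
    obtain ⟨F, hF, hfin, hd⟩ := many ih'
    exact ⟨E ∪ F, Set.union_subset hE hF, efin.union hfin,
      .inclDistr (ed.mono Set.subset_union_left) fun A hA => (hd A hA).mono Set.subset_union_right⟩
  | diaInclDistr _ ih => exact one ih .diaInclDistr
  | diaBoxInclExc _ ih => exact one ih .diaBoxInclExc
  | boxDiaInclExc _ _ i₁ i₂ => exact two i₁ i₂ .boxDiaInclExc
  | boxOrInclE _ _ _ i i₁ i₂ =>
    obtain ⟨E, hE, efin, ed⟩ := i
    obtain ⟨F, hF, hfin, hd⟩ := discharge i₁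
    obtain ⟨G, hG, gfin, gd⟩ := discharge i₂
    refine ⟨E ∪ (F ∪ G), Set.union_subset hE (Set.union_subset hF hG),
      efin.union (hfin.union gfin),
      .boxOrInclE (ed.mono Set.subset_union_left) (hd.mono (Set.insert_subset_insert ?_))
        (gd.mono (Set.insert_subset_insert ?_))⟩
    · exact fun γ hγ => .inr (.inl hγ)
    · exact fun γ hγ => .inr (.inr hγ)
  | inclDiaDistr _ _ ih ih' =>
    obtain ⟨E, hE, efin, ed⟩ := ih
    obtain ⟨F, hF, hfin, hd⟩ := many ih'
    exact ⟨E ∪ F, Set.union_subset hE hF, efin.union hfin,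
      .inclDiaDistr (ed.mono Set.subset_union_left)
        fun A hA => (hd A hA).mono Set.subset_union_right⟩

/-! ### Case analysis on inclusion atoms, and cut -/

theorem or_comm (h : Derivable Γ (.or φ ψ)) : Derivable Γ (.or ψ φ) :=
  .orE h (.orIr hyp) (.orIl hyp)

/-- A team either realises `a^x` or satisfies `¬a^x` throughout. -/
theorem prim_or_neg {n : ℕ} (x : Fin (n + 1) → Bool) (a : Fin (n + 1) → ML P) :
    Derivable Γ (.or (prim x a) (.neg (ML.pow a x))) :=
  or_comm (.inclRdt .inclId)

theorem prim_cases {n : ℕ} {x : Fin (n + 1) → Bool} {a : Fin (n + 1) → ML P}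
    (h₁ : Derivable (insert (prim x a) Γ) χ)
    (h₂ : Derivable (insert (.neg (ML.pow a x)) Γ) χ) : Derivable Γ χ :=
  .orInclE (prim_or_neg x a) h₁ h₂

theorem prim_of_pow {n : ℕ} {x : Fin (n + 1) → Bool} {a : Fin (n + 1) → ML P}
    (h : Derivable Γ (prim₁ true (ML.pow a x))) : Derivable Γ (prim x a) :=
  prim_cases hyp (.inclNegE (x := fun _ => true) (a := fun _ => ML.pow a x) hyp h.weaken)

theorem prim₁_cases (h₁ : Derivable (insert (prim₁ true α) Γ) χ)
    (h₂ : Derivable (insert (.neg α) Γ) χ) : Derivable Γ χ :=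
  prim_cases (x := fun _ => true) (a := fun _ : Fin 1 => α) h₁ h₂

theorem prim₁_absurd (h : Derivable Γ (prim₁ true α)) (hn : Derivable Γ (.neg α)) :
    Derivable Γ χ :=
  .inclNegE (x := fun _ => true) (a := fun _ : Fin 1 => α) hn h

/-- The two premises combine to the atom `⊤⊤ ⊆ α(¬α)`, which is refuted by `¬(α ∧ ¬α)`; this does
not pass through `¬¬α`, whose introduction is restricted to classical side assumptions. -/
theorem prim₁_neg_absurd (h : Derivable Γ (ofML α)) (hn : Derivable Γ (prim₁ true α.neg)) :
    Derivable Γ χ := by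
  have h2 : Derivable Γ (prim (fun _ => true) (Fin.cons α fun _ : Fin 1 => α.neg)) := by
    have := Derivable.inclExp (x := true) (α := α) h hn
    convert this using 1
    simp only [prim]
    congr 1
    funext i
    refine Fin.cases rfl (fun j => rfl) i
  refine .inclNegE ?_ h2
  have hh : Derivable (insert (ofML (.and α α.neg)) (classicalPart Γ)) (ofML (.and α α.neg)) := hyp
  exact .negI (.negE (.andEl hh) (.andEr hh))

theorem prim₁_neg_or (α : ML P) : Derivable Γ (.or (prim₁ true α.neg) (ofML α)) :=
  .orE (prim_or_neg (fun _ => true) fun _ : Fin 1 => α.neg) (.orIl hyp)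
    (.orIr (.raa (.negE (α := α.neg) hyp
      (.assumption (.inr ⟨.inl rfl, isClassical_ofML α.neg.neg⟩)))))

/-- Cut. A classical cut formula `α` is not substituted but produced by the case distinction between
`⊤ ⊆ ¬α` and `α`, whose rule has no restriction on side assumptions. -/
theorem cut (h : Derivable Γ φ) (h' : Derivable (insert φ Γ) χ) : Derivable Γ χ := by
  by_cases hφ : φ.IsClassical
  · obtain ⟨α, rfl⟩ := hφ
    exact .orInclE (prim₁_neg_or α) (prim₁_neg_absurd h.weaken hyp) h'
  · refine h'.subst ?_ ?_
    · rintro γ (rfl | hγ)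
      exacts [h, .assumption hγ]
    · rintro γ (rfl | hγ) hc
      exacts [absurd hc hφ, hγ]

theorem cut_set (h : Derivable Δ χ) (hd : ∀ δ ∈ Δ, Derivable Γ δ) : Derivable Γ χ := by
  obtain ⟨F, hF, hfin, h⟩ := h.exists_finite
  have key : Derivable (F ∪ Γ) χ → Derivable Γ χ := by
    clear h
    induction F, hfin using Set.Finite.induction_on with
    | empty => simp
    | @insert δ F _ _ ih =>
      rw [Set.insert_subset_iff] at hF
      rw [Set.insert_union]
      exact fun h => ih hF.2 (cut ((hd δ hF.1).mono Set.subset_union_right) h)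
  exact key (h.mono Set.subset_union_left)

theorem trans (h : Derivable Γ φ) (h' : Derivable {φ} ψ) : Derivable Γ ψ :=
  h'.cut_set fun _ hδ => hδ ▸ h

/-- If any two members of `B` follow from a third one, a derivation from `B` needs only one member
of `B`. -/
theorem exists_of_directed {B : Set (MLI P)} (hne : B.Nonempty)
    (hdir : ∀ b ∈ B, ∀ c ∈ B, ∃ d ∈ B, Derivable {d} b ∧ Derivable {d} c)
    (h : Derivable (Δ ∪ B) χ) : ∃ b ∈ B, Derivable (insert b Δ) χ := by
  obtain ⟨F, hF, hfin, h⟩ := h.exists_finite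
  have key : ∃ b ∈ B, ∀ γ ∈ F, Derivable (insert b Δ) γ := by
    clear h
    induction F, hfin using Set.Finite.induction_on with
    | empty => exact hne.imp fun b hb => ⟨hb, by simp⟩
    | @insert δ F _ _ ih =>
      rw [Set.insert_subset_iff] at hF
      obtain ⟨b, hb, hbF⟩ := ih hF.2
      rcases hF.1 with hδ | hδ
      · refine ⟨b, hb, ?_⟩
        rintro γ (rfl | hγ)
        exacts [.assumption (.inr hδ), hbF γ hγ]
      · obtain ⟨d, hd, h₁, h₂⟩ := hdir b hb δ hδ
        refine ⟨d, hd, ?_⟩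
        rintro γ (rfl | hγ)
        · exact h₂.of_singleton
        · refine (hbF γ hγ).cut_set ?_
          rintro γ' (rfl | hγ')
          exacts [h₁.of_singleton, .assumption (.inr hγ')]
  obtain ⟨b, hb, hbF⟩ := key
  exact ⟨b, hb, h.cut_set hbF⟩

/-! ### Derived rules -/

theorem or_mono_left (h : Derivable Γ (.or φ ψ)) (h' : Derivable {φ} φ') :
    Derivable Γ (.or φ' ψ) :=
  .orE h (.orIl h'.of_singleton) (.orIr hyp)

theorem neg_neg_intro (h : Derivable Γ (ofML α)) : Derivable Γ (.neg α.neg) :=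
  h.trans (.negI (.negE (α := α) (.assumption (.inr ⟨rfl, isClassical_ofML α⟩)) hyp))

theorem of_neg_neg (h : Derivable Γ (.neg α.neg)) : Derivable Γ (ofML α) :=
  h.trans (.raa (.negE (α := α.neg) hyp (.assumption (.inr ⟨rfl, isClassical_ofML α.neg.neg⟩))))

theorem neg_mono (h : Derivable Γ (.neg α)) (h' : Derivable {ofML β} (ofML α)) :
    Derivable Γ (.neg β) :=
  h.trans (.negI (.negE h'.of_singleton (.assumption (.inr ⟨rfl, isClassical_ofML α.neg⟩))))

theorem prim₁_mono (h : Derivable Γ (prim₁ true α)) (h' : Derivable {ofML α} (ofML β)) :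
    Derivable Γ (prim₁ true β) :=
  prim₁_cases hyp (prim₁_absurd h.weaken (neg_mono hyp h'))

theorem dia_prim₁ (h : Derivable Γ (.dia (prim₁ true α))) : Derivable Γ (prim₁ true (.dia α)) :=
  .diaInclDistr (x := fun _ => true) (a := fun _ : Fin 1 => α) h

theorem box_prim₁ (h : Derivable Γ (prim₁ true (.dia α))) : Derivable Γ (.box (prim₁ true α)) :=
  .diaBoxInclExc (x := fun _ => true) (a := fun _ : Fin 1 => α) h

theorem neg_dia_neg (h : Derivable Γ (.box (ofML α))) : Derivable Γ (.neg (.dia α.neg)) := by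
  refine h.trans (.negI ?_)
  refine .negE (α := .box α) (.assumption (.inr ⟨rfl, isClassical_ofML (.box α)⟩)) ?_
  exact .boxDiaInter (.assumption (.inl rfl))

theorem dia_of_neg_box_neg (h : Derivable Γ (.neg (.box α.neg))) :
    Derivable Γ (.dia (ofML α)) :=
  .diaMon (of_neg_neg (.assumption rfl)) (.diaBoxInter h)

theorem box_neg_of_neg_dia (h : Derivable Γ (.neg (.dia α))) : Derivable Γ (.box (.neg α)) :=
  of_neg_neg (α := .box α.neg) (neg_mono h (dia_of_neg_box_neg (.assumption rfl)))

/-- The formula `φ` need not be classical, so that `φ` does not split along `α`. Instead either `α`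
holds throughout the successor team or `¬α` is realised in it, and then `◇¬α` is realised in the
present team. -/
theorem dia_and_of_box (h : Derivable Γ (.dia φ)) (hb : Derivable Γ (.box (ofML α))) :
    Derivable Γ (.dia (.and φ (ofML α))) := by
  have h₁ : Derivable {φ} (.or (prim₁ true α.neg) (.and φ (ofML α))) :=
    .orInclE (prim₁_neg_or α) (.orIl hyp) (.orIr (.andI (.assumption (.inr rfl)) hyp))
  have h₂ : Derivable Γ (.or (prim₁ true (.dia α.neg)) (.dia (.and φ (ofML α)))) :=
    or_mono_left (.diaOrDistr (.diaMon h₁ h)) (dia_prim₁ (.assumption rfl))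
  refine .orInclE (x := fun _ => true) (a := fun _ : Fin 1 => .dia α.neg) h₂ ?_ hyp
  exact prim₁_absurd hyp (neg_dia_neg hb).weaken

/-- The set of formulas that are derivably necessary is deductively closed. -/
theorem box_of_derivable (h : Derivable {φ | Derivable Γ (.box φ)} ψ) : Derivable Γ (.box ψ) := by
  obtain ⟨F, hF, hfin, h⟩ := h.exists_finite
  refine .boxMon (l := hfin.toFinset.toList) (h.mono fun γ hγ => by simpa using hγ) ?_
  exact fun γ hγ => hF (by simpa using hγ)

theorem andAll_elim {l : List (MLI P)} (h : Derivable Γ (andAll φ l)) :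
    Derivable Γ φ ∧ ∀ ψ ∈ l, Derivable Γ ψ := by
  induction l generalizing φ with
  | nil => exact ⟨h, by simp⟩
  | cons ψ l ih =>
    obtain ⟨h₁, h₂⟩ := ih (φ := .and φ ψ) h
    refine ⟨.andEl h₁, fun χ hχ => ?_⟩
    rcases List.mem_cons.1 hχ with rfl | hχ
    exacts [.andEr h₁, h₂ χ hχ]

theorem orAll_elim {l : List (MLI P)} (h : Derivable Γ (orAll φ l)) (hφ : Derivable {φ} χ)
    (hl : ∀ ψ ∈ l, Derivable {ψ} χ) : Derivable Γ χ := by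
  induction l generalizing φ with
  | nil => exact h.trans hφ
  | cons ψ l ih =>
    refine ih (φ := .or φ ψ) h ?_ fun χ hχ => hl χ (by simp [hχ])
    exact .orE (.assumption rfl) hφ.of_singleton (hl ψ (by simp)).of_singleton

theorem cubeConj_intro {n : ℕ} {f : (Fin n → Bool) → MLI P} (h : ∀ x, Derivable Γ (f x)) :
    Derivable Γ (cubeConj n f) := by
  induction n with
  | zero => exact h _
  | succ n ih => exact .andI (ih fun x => h _) (ih fun x => h _)

/-- Realised formulas that imply the left disjunct are moved into its part of the team. -/
theorem or_of_prim₁ {l : List (ML P)} (h : Derivable Γ (.or (ofML α) ψ))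
    (hl : ∀ β ∈ l, Derivable Γ (prim₁ true β)) (hα : ∀ β ∈ l, Derivable {ofML β} (ofML α))
    (hχ : Derivable (insert (ofML α) {φ | ∃ β ∈ l, φ = prim₁ true β}) χ) :
    Derivable Γ (.or χ ψ) := by
  have h₁ := Derivable.inclDistr (l := l.map fun β => ⟨0, fun _ => true, fun _ => β⟩) h (by
    intro A hA
    obtain ⟨β, hβ, rfl⟩ := List.mem_map.1 hA
    exact hl β hβ)
  refine or_mono_left h₁ (hχ.cut_set ?_)
  obtain ⟨h₂, h₃⟩ := andAll_elim (Γ := {_}) (.assumption rfl)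
  rintro _ (rfl | ⟨β, hβ, rfl⟩)
  · refine orAll_elim h₂ (.assumption rfl) fun ψ hψ => ?_
    simp only [List.map_map, List.mem_map] at hψ
    obtain ⟨β, hβ, rfl⟩ := hψ
    exact hα β hβ
  · exact h₃ _ (List.mem_map.2 ⟨_, List.mem_map.2 ⟨β, hβ, rfl⟩, rfl⟩)

/-- Formulas that are realised in some successor and imply `α` are realised in a successor team
satisfying `α`. -/
theorem dia_of_prim₁ {l : List (ML P)} (h : Derivable Γ (.dia (ofML α)))
    (hl : ∀ β ∈ l, Derivable Γ (prim₁ true (.dia β)))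
    (hα : ∀ β ∈ l, Derivable {ofML β} (ofML α))
    (hχ : Derivable (insert (ofML α) {φ | ∃ β ∈ l, φ = prim₁ true β}) χ) :
    Derivable Γ (.dia χ) := by
  have h₁ := Derivable.inclDiaDistr (l := l.map fun β => (true, β)) h (by
    intro A hA
    obtain ⟨β, hβ, rfl⟩ := List.mem_map.1 hA
    exact hl β hβ)
  refine .diaMon (hχ.cut_set ?_) h₁
  obtain ⟨h₂, h₃⟩ := andAll_elim (Γ := {_}) (.assumption rfl)
  rintro _ (rfl | ⟨β, hβ, rfl⟩)
  · refine orAll_elim h₂ (.assumption rfl) fun ψ hψ => ?_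
    simp only [List.map_map, List.mem_map] at hψ
    obtain ⟨β, hβ, rfl⟩ := hψ
    exact hα β hβ
  · exact h₃ _ (List.mem_map.2 ⟨_, List.mem_map.2 ⟨β, hβ, rfl⟩, rfl⟩)

end Derivable

/-! ### Soundness -/

namespace ML

variable {P : Type} {M : KripkeModel.{v} P}

theorem sat_empty (α : ML P) : Sat M ∅ α := by
  induction α with
  | var p => exact Set.empty_subset _
  | bot => rfl
  | neg α _ => exact fun w hw => hw.elim
  | or α β i j => exact ⟨∅, ∅, Set.union_self _, i, j⟩
  | and α β i j => exact ⟨i, j⟩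
  | dia α i => exact ⟨∅, ⟨Set.empty_subset _, Set.empty_subset _⟩, i⟩
  | box α i =>
    have : M.image ∅ = ∅ := by simp [KripkeModel.image]
    simpa only [Sat, this] using i

/-- Classical formulas are flat. -/
theorem sat_iff_forall {T : Set M.W} {α : ML P} : Sat M T α ↔ ∀ w ∈ T, Sat M {w} α := by
  induction α generalizing T with
  | var p => simp [Sat, Set.subset_def]
  | bot => simp [Sat, Set.eq_empty_iff_forall_notMem]
  | neg α _ => simp [Sat]
  | or α β i j =>
    constructor
    · rintro ⟨T₁, T₂, rfl, h₁, h₂⟩ w (hw | hw)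
      · exact ⟨{w}, ∅, Set.union_empty _, i.1 h₁ w hw, sat_empty β⟩
      · exact ⟨∅, {w}, Set.empty_union _, sat_empty α, j.1 h₂ w hw⟩
    · intro h
      refine ⟨{w ∈ T | Sat M {w} α}, {w ∈ T | Sat M {w} β}, ?_, i.2 fun w hw => hw.2,
        j.2 fun w hw => hw.2⟩
      refine (Set.union_subset (Set.sep_subset _ _) (Set.sep_subset _ _)).antisymm fun w hw => ?_
      obtain ⟨T₁, T₂, hT, h₁, h₂⟩ := h w hw
      rcases (hT ▸ rfl : w ∈ T₁ ∪ T₂) with hw' | hw'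
      exacts [.inl ⟨hw, i.1 h₁ w hw'⟩, .inr ⟨hw, j.1 h₂ w hw'⟩]
  | and α β i j =>
    simp only [Sat]
    rw [i, j]
    exact ⟨fun h w hw => ⟨h.1 w hw, h.2 w hw⟩, fun h =>
      ⟨fun w hw => (h w hw).1, fun w hw => (h w hw).2⟩⟩
  | dia α i =>
    constructor
    · rintro ⟨S, ⟨_, h₂⟩, hS⟩ w hw
      obtain ⟨u, hu, hwu⟩ := h₂ hw
      refine ⟨{u}, ⟨?_, ?_⟩, i.1 hS u hu⟩
      · rintro _ rfl
        exact ⟨w, rfl, hwu⟩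
      · rintro _ rfl
        exact ⟨u, rfl, hwu⟩
    · intro h
      refine ⟨{u ∈ M.image T | Sat M {u} α}, ⟨Set.sep_subset _ _, fun w hw => ?_⟩,
        i.2 fun u hu => hu.2⟩
      obtain ⟨S, ⟨_, h₂⟩, hS⟩ := h w hw
      obtain ⟨u, hu, hwu⟩ := h₂ (Set.mem_singleton w)
      exact ⟨u, ⟨⟨w, hw, hwu⟩, i.1 hS u hu⟩, hwu⟩
  | box α i =>
    simp only [Sat]
    rw [i]
    constructor
    · intro h w hw
      rw [i]
      rintro u ⟨w', rfl, hu⟩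
      exact h u ⟨_, hw, hu⟩
    · rintro h u ⟨w, hw, hu⟩
      exact i.1 (h w hw) u ⟨w, rfl, hu⟩

theorem sat_neg_iff {w : M.W} {α : ML P} : Sat M {w} (neg α) ↔ ¬ Sat M {w} α := by
  simp [Sat]

theorem sat_const_iff {w : M.W} {x : Bool} : Sat M {w} (const x) ↔ x = true := by
  cases x <;> simp [const, top, Sat]

theorem sat_lit_iff {w : M.W} {α : ML P} {x : Bool} :
    Sat M {w} (α.lit x) ↔ (x = true ↔ Sat M {w} α) := by
  cases x <;> simp [lit, Sat]

theorem sat_conj_iff {n : ℕ} {T : Set M.W} {a : Fin (n + 1) → ML P} :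
    Sat M T (conj a) ↔ ∀ i, Sat M T (a i) := by
  induction n with
  | zero => simp [conj]
  | succ n ih => rw [Fin.forall_fin_succ, ← ih]; rfl

theorem sat_pow_iff {n : ℕ} {w : M.W} {a : Fin (n + 1) → ML P} {x : Fin (n + 1) → Bool} :
    Sat M {w} (pow a x) ↔ ∀ i, x i = true ↔ Sat M {w} (a i) := by
  simp only [pow, sat_conj_iff, sat_lit_iff]

theorem sat_singleton_dia_iff {w : M.W} {α : ML P} :
    Sat M {w} (dia α) ↔ ∃ u, M.R w u ∧ Sat M {u} α := by
  constructor
  · rintro ⟨S, ⟨_, h₂⟩, hS⟩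
    obtain ⟨u, hu, hwu⟩ := h₂ (Set.mem_singleton w)
    exact ⟨u, hwu, sat_iff_forall.1 hS u hu⟩
  · rintro ⟨u, hwu, hu⟩
    refine ⟨{u}, ⟨?_, ?_⟩, hu⟩
    · rintro _ rfl
      exact ⟨w, rfl, hwu⟩
    · rintro _ rfl
      exact ⟨u, rfl, hwu⟩

theorem sat_singleton_box_iff {w : M.W} {α : ML P} :
    Sat M {w} (box α) ↔ ∀ u, M.R w u → Sat M {u} α := by
  simp only [Sat]
  rw [sat_iff_forall]
  exact ⟨fun h u hu => h u ⟨w, rfl, hu⟩, by rintro h u ⟨_, rfl, hu⟩; exact h u hu⟩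

end ML

namespace MLI

variable {P : Type} {M : KripkeModel.{v} P}

theorem sat_empty (φ : MLI P) : Sat M ∅ φ := by
  induction φ with
  | var p => exact Set.empty_subset _
  | bot => rfl
  | incl n a b => exact fun w hw => hw.elim
  | neg α => exact fun w hw => hw.elim
  | or φ ψ i j => exact ⟨∅, ∅, Set.union_self _, i, j⟩
  | and φ ψ i j => exact ⟨i, j⟩
  | dia φ i => exact ⟨∅, ⟨Set.empty_subset _, Set.empty_subset _⟩, i⟩
  | box φ i =>
    have : M.image ∅ = ∅ := by simp [KripkeModel.image]
    simpa only [Sat, this] using i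

theorem sat_union {φ : MLI P} {T S : Set M.W} (hT : Sat M T φ) (hS : Sat M S φ) :
    Sat M (T ∪ S) φ := by
  induction φ generalizing T S with
  | var p => exact Set.union_subset hT hS
  | bot => exact Set.union_empty_iff.2 ⟨hT, hS⟩
  | incl n a b =>
    rintro w (hw | hw)
    · exact (hT w hw).imp fun u hu => ⟨.inl hu.1, hu.2⟩
    · exact (hS w hw).imp fun u hu => ⟨.inr hu.1, hu.2⟩
  | neg α => exact fun w hw => hw.elim (hT w) (hS w)
  | or φ ψ i j =>
    obtain ⟨T₁, T₂, rfl, h₁, h₂⟩ := hT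
    obtain ⟨S₁, S₂, rfl, h₃, h₄⟩ := hS
    exact ⟨T₁ ∪ S₁, T₂ ∪ S₂, Set.union_union_union_comm _ _ _ _, i h₁ h₃, j h₂ h₄⟩
  | and φ ψ i j => exact ⟨i hT.1 hS.1, j hT.2 hS.2⟩
  | dia φ i =>
    obtain ⟨T', ⟨h₁, h₂⟩, hT'⟩ := hT
    obtain ⟨S', ⟨h₃, h₄⟩, hS'⟩ := hS
    refine ⟨T' ∪ S', ⟨?_, ?_⟩, i hT' hS'⟩
    · rintro u (hu | hu)
      · exact (h₁ hu).imp fun w hw => ⟨.inl hw.1, hw.2⟩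
      · exact (h₃ hu).imp fun w hw => ⟨.inr hw.1, hw.2⟩
    · rintro w (hw | hw)
      · exact (h₂ hw).imp fun u hu => ⟨.inl hu.1, hu.2⟩
      · exact (h₄ hw).imp fun u hu => ⟨.inr hu.1, hu.2⟩
  | box φ i =>
    have : M.image (T ∪ S) = M.image T ∪ M.image S := by
      ext u
      simp only [KripkeModel.image, Set.mem_ofPred_eq, Set.mem_union]
      grind
    simp only [Sat, this]
    exact i hT hS

theorem sat_of_classical {φ : MLI P} (hφ : φ.IsClassical) {T S : Set M.W} (hS : S ⊆ T)
    (h : Sat M T φ) : Sat M S φ := by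
  obtain ⟨α, rfl⟩ := hφ
  rw [sat_ofML, ML.sat_iff_forall] at h ⊢
  exact fun w hw => h w (hS hw)

theorem sat_prim_iff {n : ℕ} {T : Set M.W} {x : Fin (n + 1) → Bool} {a : Fin (n + 1) → ML P} :
    Sat M T (prim x a) ↔ (T.Nonempty → ∃ u ∈ T, ML.Sat M {u} (ML.pow a x)) := by
  simp only [prim, Sat, ML.sat_const_iff, ML.sat_pow_iff]
  exact ⟨fun h ⟨w, hw⟩ => h w hw, fun h w hw => h ⟨w, hw⟩⟩

theorem sat_prim₁_iff {T : Set M.W} {x : Bool} {α : ML P} :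
    Sat M T (prim₁ x α) ↔ (T.Nonempty → ∃ u ∈ T, ML.Sat M {u} (α.lit x)) :=
  sat_prim_iff (x := fun _ => x) (a := fun _ : Fin 1 => α)

theorem sat_cubeConj {n : ℕ} {T : Set M.W} {f : (Fin n → Bool) → MLI P}
    (h : Sat M T (cubeConj n f)) (x : Fin n → Bool) : Sat M T (f x) := by
  induction n with
  | zero => exact Subsingleton.elim Fin.elim0 x ▸ h
  | succ n ih =>
    rw [← Fin.cons_self_tail x]
    cases x 0
    exacts [ih h.2 _, ih h.1 _]

theorem sat_andAll {T : Set M.W} {φ : MLI P} {l : List (MLI P)} (h : Sat M T φ)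
    (hl : ∀ ψ ∈ l, Sat M T ψ) : Sat M T (andAll φ l) := by
  induction l generalizing φ with
  | nil => exact h
  | cons ψ l ih =>
    exact ih (φ := .and φ ψ) ⟨h, hl ψ (by simp)⟩ fun χ hχ => hl χ (by simp [hχ])

/-- Adding to a team, for each of finitely many formulas, one world at which that formula is
true. -/
theorem sat_orAll {ι : Type*} {l : List ι} {f : ι → ML P} {u : ι → M.W} {T : Set M.W} {φ : MLI P}
    (h : Sat M T φ) (hu : ∀ i ∈ l, ML.Sat M {u i} (f i)) :
    Sat M (T ∪ {w | ∃ i ∈ l, u i = w}) (orAll φ (l.map fun i => ofML (f i))) := by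
  induction l generalizing T φ with
  | nil => simpa [orAll] using h
  | cons i l ih =>
    have := ih (T := T ∪ {u i}) (φ := .or φ (ofML (f i)))
      ⟨T, {u i}, rfl, h, (sat_ofML M _ _).2 (hu i (by simp))⟩ fun j hj => hu j (by simp [hj])
    have hT : T ∪ {w | ∃ j ∈ i :: l, u j = w} = T ∪ {u i} ∪ {w | ∃ j ∈ l, u j = w} := by
      ext w
      simp only [List.mem_cons, Set.mem_union, Set.mem_ofPred_eq, Set.mem_singleton_iff]
      grind
    exact hT ▸ this

end MLI

namespace Derivable

open MLI

variable {P : Type} {Γ : Set (MLI P)} {φ : MLI P}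

theorem sound (h : Derivable Γ φ) : Entails.{v} Γ φ := by
  have hins : ∀ {Γ : Set (MLI P)} {φ : MLI P} {M : KripkeModel.{v} P} {T : Set M.W},
      Sat M T φ → (∀ γ ∈ Γ, Sat M T γ) → ∀ γ ∈ insert φ Γ, Sat M T γ := by
    rintro Γ φ M T h hΓ γ (rfl | hγ)
    exacts [h, hΓ γ hγ]
  have hcl : ∀ {Γ : Set (MLI P)} {M : KripkeModel.{v} P} {T S : Set M.W}, S ⊆ T →
      (∀ γ ∈ Γ, Sat M T γ) → ∀ γ ∈ classicalPart Γ, Sat M S γ :=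
    fun hS hΓ γ hγ => sat_of_classical hγ.2 hS (hΓ γ hγ.1)
  induction h with
  | assumption hm => exact fun M T hT => hT _ hm
  | @negI Γ α _ ih =>
    intro M T hT w hw hα
    exact Set.singleton_ne_empty w
      (ih M {w} (hins ((sat_ofML M _ _).2 hα) (hcl (Set.singleton_subset_iff.2 hw) hT)))
  | @raa Γ α _ ih =>
    intro M T hT
    rw [sat_ofML, ML.sat_iff_forall]
    intro w hw
    by_contra hα
    exact Set.singleton_ne_empty w
      (ih M {w} (hins (by simpa [Sat] using hα) (hcl (Set.singleton_subset_iff.2 hw) hT)))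
  | negE _ _ i₁ i₂ =>
    intro M T hT
    have h₁ := i₁ M T hT
    have h₂ := i₂ M T hT
    rw [sat_ofML, ML.sat_iff_forall] at h₁
    obtain rfl : T = ∅ := Set.eq_empty_of_forall_notMem fun w hw => h₂ w hw (h₁ w hw)
    exact MLI.sat_empty _
  | orIl _ ih => exact fun M T hT => ⟨T, ∅, Set.union_empty T, ih M T hT, MLI.sat_empty _⟩
  | orIr _ ih => exact fun M T hT => ⟨∅, T, Set.empty_union T, MLI.sat_empty _, ih M T hT⟩
  | orE _ _ _ i i₁ i₂ =>
    intro M T hT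
    obtain ⟨T₁, T₂, rfl, h₁, h₂⟩ := i M T hT
    exact sat_union (i₁ M T₁ (hins h₁ (hcl Set.subset_union_left hT)))
      (i₂ M T₂ (hins h₂ (hcl Set.subset_union_right hT)))
  | andI _ _ i₁ i₂ => exact fun M T hT => ⟨i₁ M T hT, i₂ M T hT⟩
  | andEl _ ih => exact fun M T hT => (ih M T hT).1
  | andEr _ ih => exact fun M T hT => (ih M T hT).2
  | @diaBoxInter Γ α _ ih =>
    intro M T hT
    have h := ih M T hT
    refine (sat_ofML M T (.dia (.neg α))).2 (ML.sat_iff_forall.2 fun w hw => ?_)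
    have hw' := h w hw
    rw [ML.sat_singleton_box_iff] at hw'
    rw [ML.sat_singleton_dia_iff]
    push Not at hw'
    simpa only [ML.sat_neg_iff] using hw'
  | @boxDiaInter Γ α _ ih =>
    intro M T hT w hw
    have h := ML.sat_iff_forall.1 ((sat_ofML M T (.dia (.neg α))).1 (ih M T hT)) w hw
    rw [ML.sat_singleton_dia_iff] at h
    rw [ML.sat_singleton_box_iff]
    push Not
    simpa only [ML.sat_neg_iff] using h
  | diaOrDistr _ ih =>
    intro M T hT
    obtain ⟨_, ⟨h₁, h₂⟩, S₁, S₂, rfl, hS₁, hS₂⟩ := ih M T hT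
    refine ⟨T ∩ M.preimage S₁, T ∩ M.preimage S₂, ?_, ⟨S₁, ⟨?_, Set.inter_subset_right⟩, hS₁⟩,
      ⟨S₂, ⟨?_, Set.inter_subset_right⟩, hS₂⟩⟩
    · refine (Set.union_subset Set.inter_subset_left Set.inter_subset_left).antisymm fun w hw => ?_
      obtain ⟨u, hu | hu, hwu⟩ := h₂ hw
      exacts [.inl ⟨hw, u, hu, hwu⟩, .inr ⟨hw, u, hu, hwu⟩]
    · intro u hu
      obtain ⟨w, hw, hwu⟩ := h₁ (.inl hu)
      exact ⟨w, ⟨hw, u, hu, hwu⟩, hwu⟩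
    · intro u hu
      obtain ⟨w, hw, hwu⟩ := h₁ (.inr hu)
      exact ⟨w, ⟨hw, u, hu, hwu⟩, hwu⟩
  | boxMon _ _ i ih => exact fun M T hT => i M _ fun φ hφ => ih φ hφ M T hT
  | diaMon _ _ i ih =>
    intro M T hT
    obtain ⟨S, hS, h⟩ := ih M T hT
    exact ⟨S, hS, i M S fun γ hγ => hγ ▸ h⟩
  | inclId => exact fun M T _ w hw => ⟨w, hw, fun _ => Iff.rfl⟩
  | @inclExp Γ n α x b c _ _ i₁ i₂ =>
    intro M T hT w hw
    obtain ⟨u, hu, h⟩ := i₂ M T hT w hw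
    have hα := ML.sat_iff_forall.1 ((sat_ofML M T _).1 (i₁ M T hT)) u hu
    refine ⟨u, hu, Fin.cases ?_ h⟩
    simpa only [Fin.cons_zero, ML.sat_const_iff] using ML.sat_lit_iff.1 hα
  | inclNegE _ _ i₁ i₂ =>
    intro M T hT
    rcases T.eq_empty_or_nonempty with rfl | hne
    · exact MLI.sat_empty _
    · obtain ⟨u, hu, h⟩ := sat_prim_iff.1 (i₂ M T hT) hne
      exact absurd h (i₁ M T hT u hu)
  | orInclE _ _ _ i i₁ i₂ =>
    intro M T hT
    obtain ⟨T₁, T₂, rfl, h₁, h₂⟩ := i M T hT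
    rcases T₁.eq_empty_or_nonempty with rfl | hne
    · exact i₂ M _ (hins (by simpa using h₂) hT)
    · refine i₁ M _ (hins (sat_prim_iff.2 fun _ => ?_) hT)
      exact (sat_prim_iff.1 h₁ hne).imp fun u hu => ⟨.inl hu.1, hu.2⟩
  | @inclExt Γ n a b _ ih =>
    classical
    intro M T hT w hw
    obtain ⟨T₁, T₂, hU, h₁, h₂⟩ := sat_cubeConj (ih M T hT) fun i => decide (ML.Sat M {w} (a i))
    rcases (hU ▸ hw : w ∈ T₁ ∪ T₂) with hw' | hw'
    · exact absurd (ML.sat_pow_iff.2 fun i => decide_eq_true_iff) (h₁ w hw')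
    · obtain ⟨u, hu, h⟩ := sat_prim_iff.1 h₂ ⟨w, hw'⟩
      refine ⟨u, hU ▸ .inr hu, fun i => ?_⟩
      rw [← ML.sat_pow_iff.1 h i, decide_eq_true_iff]
  | @inclRdt Γ n a b x _ ih =>
    intro M T hT
    by_cases h : ∃ w ∈ T, ML.Sat M {w} (ML.pow a x)
    · obtain ⟨w, hw, hwx⟩ := h
      obtain ⟨u, hu, hwu⟩ := ih M T hT w hw
      refine ⟨∅, T, Set.empty_union T, MLI.sat_empty _, sat_prim_iff.2 fun _ => ⟨u, hu, ?_⟩⟩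
      exact ML.sat_pow_iff.2 fun i => (ML.sat_pow_iff.1 hwx i).trans (hwu i)
    · push Not at h
      exact ⟨T, ∅, Set.union_empty T, h, MLI.sat_empty _⟩
  | @inclDistr Γ φ ψ l _ _ ih ih' =>
    intro M T hT
    rcases T.eq_empty_or_nonempty with rfl | hne
    · exact MLI.sat_empty _
    obtain ⟨T₁, T₂, rfl, h₁, h₂⟩ := ih M T hT
    have hl : ∀ A : PrimAtom P, ∃ u, A ∈ l → u ∈ T₁ ∪ T₂ ∧ ML.Sat M {u} (ML.pow A.a A.x) := by
      intro A
      by_cases hA : A ∈ l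
      · obtain ⟨u, hu⟩ := sat_prim_iff.1 (ih' A hA M _ hT) hne
        exact ⟨u, fun _ => hu⟩
      · exact ⟨hne.some, fun h => absurd h hA⟩
    choose u hu using hl
    refine ⟨T₁ ∪ {w | ∃ A ∈ l, u A = w}, T₂, ?_, sat_andAll ?_ ?_, h₂⟩
    · refine Set.Subset.antisymm (Set.union_subset (Set.union_subset Set.subset_union_left ?_)
        Set.subset_union_right) (Set.union_subset_union_left _ Set.subset_union_left)
      rintro _ ⟨A, hA, rfl⟩
      exact (hu A hA).1
    · exact sat_orAll h₁ fun A hA => (hu A hA).2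
    · intro χ hχ
      obtain ⟨A, hA, rfl⟩ := List.mem_map.1 hχ
      exact sat_prim_iff.2 fun _ => ⟨u A, .inr ⟨A, hA, rfl⟩, (hu A hA).2⟩
  | diaInclDistr _ ih =>
    intro M T hT
    obtain ⟨S, ⟨h₁, h₂⟩, hS⟩ := ih M T hT
    refine sat_prim₁_iff.2 fun ⟨w, hw⟩ => ?_
    obtain ⟨u, hu, -⟩ := h₂ hw
    obtain ⟨v, hv, h⟩ := sat_prim_iff.1 hS ⟨u, hu⟩
    obtain ⟨w', hw', hwv⟩ := h₁ hv
    exact ⟨w', hw', ML.sat_singleton_dia_iff.2 ⟨v, hwv, h⟩⟩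
  | diaBoxInclExc _ ih =>
    intro M T hT
    refine sat_prim_iff.2 fun ⟨u, w, hw, _⟩ => ?_
    obtain ⟨w', hw', h⟩ := sat_prim₁_iff.1 (ih M T hT) ⟨w, hw⟩
    obtain ⟨v, hwv, hv⟩ := ML.sat_singleton_dia_iff.1 h
    exact ⟨v, ⟨w', hw', hwv⟩, hv⟩
  | boxDiaInclExc _ _ i₁ i₂ =>
    intro M T hT
    refine sat_prim₁_iff.2 fun hne => ?_
    obtain ⟨w, hw, h⟩ := sat_prim₁_iff.1 (i₁ M T hT) hne
    obtain ⟨v, hwv, -⟩ := ML.sat_singleton_dia_iff.1 h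
    obtain ⟨u, ⟨w', hw', hwu⟩, hu⟩ := sat_prim_iff.1 (i₂ M T hT) ⟨v, w, hw, hwv⟩
    exact ⟨w', hw', ML.sat_singleton_dia_iff.2 ⟨u, hwu, hu⟩⟩
  | boxOrInclE _ _ _ i i₁ i₂ =>
    intro M T hT
    obtain ⟨S₁, S₂, hU, h₁, h₂⟩ := i M T hT
    rcases S₁.eq_empty_or_nonempty with rfl | hne
    · rw [Set.empty_union] at hU
      exact i₂ M T (hins (show Sat M (M.image T) _ from hU ▸ h₂) hT)
    · refine i₁ M T (hins (sat_prim₁_iff.2 fun _ => ?_) hT)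
      obtain ⟨u, hu, h⟩ := sat_prim_iff.1 h₁ hne
      obtain ⟨w, hw, hwu⟩ := (hU ▸ Set.subset_union_left : S₁ ⊆ M.image T) hu
      exact ⟨w, hw, ML.sat_singleton_dia_iff.2 ⟨u, hwu, h⟩⟩
  | @inclDiaDistr Γ φ l _ _ ih ih' =>
    intro M T hT
    rcases T.eq_empty_or_nonempty with rfl | hne
    · exact MLI.sat_empty _
    obtain ⟨S, ⟨h₁, h₂⟩, hS⟩ := ih M T hT
    -- A world with `¬◇α` has a successor in every successor team, and `α` fails there.
    have hl : ∀ A : Bool × ML P, ∃ u, A ∈ l → u ∈ M.image T ∧ ML.Sat M {u} (A.2.lit A.1) := by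
      rintro ⟨x, α⟩
      obtain ⟨u₀, -, -⟩ := h₂ hne.some_mem
      by_cases hA : (x, α) ∈ l
      · obtain ⟨w, hw, h⟩ := sat_prim₁_iff.1 (ih' _ hA M T hT) hne
        cases x with
        | true =>
          obtain ⟨u, hwu, hu⟩ := ML.sat_singleton_dia_iff.1 h
          exact ⟨u, fun _ => ⟨⟨w, hw, hwu⟩, hu⟩⟩
        | false =>
          obtain ⟨u, hu, hwu⟩ := h₂ hw
          refine ⟨u, fun _ => ⟨⟨w, hw, hwu⟩, ML.sat_neg_iff.2 fun hα => ?_⟩⟩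
          exact ML.sat_neg_iff.1 h (ML.sat_singleton_dia_iff.2 ⟨u, hwu, hα⟩)
      · exact ⟨u₀, fun h => absurd h hA⟩
    choose u hu using hl
    refine ⟨S ∪ {w | ∃ A ∈ l, u A = w}, ⟨Set.union_subset h₁ ?_, fun w hw => ?_⟩,
      sat_andAll ?_ ?_⟩
    · rintro _ ⟨A, hA, rfl⟩
      exact (hu A hA).1
    · exact (h₂ hw).imp fun v hv => ⟨.inl hv.1, hv.2⟩
    · exact sat_orAll hS fun A hA => (hu A hA).2
    · intro χ hχ
      obtain ⟨A, hA, rfl⟩ := List.mem_map.1 hχ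
      exact sat_prim₁_iff.2 fun _ => ⟨u A, .inr ⟨A, hA, rfl⟩, (hu A hA).2⟩

end Derivable

/-! ### The canonical model -/

/-- A world of the canonical model: a consistent set of classical formulas that contains each
classical formula or its negation. The universe level `v` is that of the worlds of the models
over which entailment quantifies. -/
structure World (P : Type) : Type v where
  carrier : Set (ML P)
  consistent : ¬ Derivable (MLI.ofML '' carrier) .bot
  complete : ∀ α, α ∈ carrier ∨ ML.neg α ∈ carrier

namespace World

open MLI

variable {P : Type}

instance : Membership (ML P) (World.{v} P) := ⟨fun w α => α ∈ w.carrier⟩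

variable {w : World.{v} P} {α β : ML P}

theorem assumption (h : α ∈ w) : Derivable (ofML '' w.carrier) (ofML α) :=
  .assumption ⟨α, h, rfl⟩

theorem mem_of_derivable (h : Derivable (ofML '' w.carrier) (ofML α)) : α ∈ w :=
  (w.complete α).resolve_right fun hn => w.consistent (.negE h (.assumption ⟨_, hn, rfl⟩))

theorem neg_mem_iff : α.neg ∈ w ↔ α ∉ w :=
  ⟨fun hn h => w.consistent (.negE (assumption h) (.assumption ⟨_, hn, rfl⟩)),
    (w.complete α).resolve_left⟩

theorem bot_notMem : ML.bot ∉ w := fun h => w.consistent (assumption h)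

theorem and_mem_iff : α.and β ∈ w ↔ α ∈ w ∧ β ∈ w :=
  ⟨fun h => ⟨mem_of_derivable (.andEl (assumption h)), mem_of_derivable (.andEr (assumption h))⟩,
    fun h => mem_of_derivable (.andI (assumption h.1) (assumption h.2))⟩

theorem or_mem_iff : α.or β ∈ w ↔ α ∈ w ∨ β ∈ w := by
  refine ⟨fun h => ?_, fun h => ?_⟩
  · by_contra! hn
    refine w.consistent (.orE (assumption h) ?_ ?_) <;> rw [classicalPart_image]
    · exact .negE .hyp (assumption (neg_mem_iff.2 hn.1)).weaken
    · exact .negE .hyp (assumption (neg_mem_iff.2 hn.2)).weaken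
  · rcases h with h | h
    exacts [mem_of_derivable (.orIl (assumption h)), mem_of_derivable (.orIr (assumption h))]

theorem conj_mem_iff {n : ℕ} {a : Fin (n + 1) → ML P} : ML.conj a ∈ w ↔ ∀ i, a i ∈ w := by
  induction n with
  | zero => simp [ML.conj]
  | succ n ih => rw [Fin.forall_fin_succ, ← ih, ← and_mem_iff]; rfl

theorem pow_mem_iff {n : ℕ} {a : Fin (n + 1) → ML P} {x : Fin (n + 1) → Bool} :
    ML.pow a x ∈ w ↔ ∀ i, x i = true ↔ a i ∈ w := by
  simp only [ML.pow, conj_mem_iff]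
  refine forall_congr' fun i => ?_
  cases x i <;> simp [ML.lit, neg_mem_iff]

/-- Lindenbaum's lemma for classical formulas. -/
theorem exists_of_consistent {X : Set (ML P)} (hX : ¬ Derivable (ofML '' X) .bot) :
    ∃ w : World.{v} P, X ⊆ w.carrier := by
  have hfc : Order.IsOfFiniteCharacter {X : Set (ML P) | ¬ Derivable (ofML '' X) .bot} := by
    refine fun X => ⟨fun h Y hY _ hd => h (hd.mono (Set.image_mono hY)), fun h hd => ?_⟩
    obtain ⟨F, hF, hfin, hd⟩ := hd.exists_finite
    obtain ⟨Y, hY, yfin, rfl⟩ := Set.exists_subset_image_finite_and.1 ⟨F, hF, hfin, rfl⟩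
    exact h Y hY yfin hd
  obtain ⟨m, hXm, hm⟩ := hfc.exists_maximal hX
  refine ⟨⟨m, hm.prop, fun α => ?_⟩, hXm⟩
  have key : ∀ α ∉ m, Derivable (insert (ofML α) (ofML '' m)) .bot := by
    intro α hα
    by_contra hd
    rw [← Set.image_insert_eq] at hd
    exact hα (hm.le_of_ge hd (Set.subset_insert _ _) (Set.mem_insert _ _))
  by_contra! hn
  have h₁ := key _ hn.1
  have h₂ := key _ hn.2
  rw [← classicalPart_image] at h₁ h₂
  exact hm.prop (.negE (.raa h₂) (.negI h₁))

/-- The accessibility relation of the canonical model. -/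
def Rel (w u : World.{v} P) : Prop := ∀ α, ML.box α ∈ w → α ∈ u

theorem box_and_mem (hα : α.box ∈ w) (hβ : β.box ∈ w) : (α.and β).box ∈ w := by
  refine mem_of_derivable (Derivable.box_of_derivable ?_)
  exact .andI (.assumption (assumption hα)) (.assumption (assumption hβ))

theorem box_top_mem : ML.top.box ∈ w :=
  mem_of_derivable (Derivable.box_of_derivable (.negI .hyp))

theorem dia_mem_of_rel {u : World.{v} P} (h : w.Rel u) (hα : α ∈ u) : α.dia ∈ w := by
  by_contra hn
  have := mem_of_derivable (α := .box α.neg) (w := w)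
    (Derivable.box_neg_of_neg_dia (assumption (neg_mem_iff.2 hn)))
  exact neg_mem_iff.1 (h _ this) hα

/-- A world sees a world containing the classical consequences of `Θ`, if `Θ` refutes none of the
formulas necessary at it. -/
theorem exists_rel_of_derivable {Θ : Set (MLI P)}
    (h : ∀ β, ML.box β ∈ w → ¬ Derivable Θ (.neg β)) :
    ∃ u : World.{v} P, w.Rel u ∧ ∀ α, Derivable Θ (ofML α) → α ∈ u := by
  have hcons : ¬ Derivable (ofML '' ({β | ML.box β ∈ w} ∪ {α | Derivable Θ (ofML α)})) .bot := by
    rw [Set.image_union, Set.union_comm]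
    intro hd
    obtain ⟨_, ⟨β, hβ, rfl⟩, hd⟩ := Derivable.exists_of_directed
      (B := ofML '' {β | ML.box β ∈ w}) (Set.Nonempty.image _ ⟨_, box_top_mem⟩) (by
        rintro _ ⟨β, hβ, rfl⟩ _ ⟨γ, hγ, rfl⟩
        exact ⟨_, ⟨β.and γ, box_and_mem hβ hγ, rfl⟩, .andEl (.assumption rfl),
          .andEr (.assumption rfl)⟩) hd
    rw [← classicalPart_image] at hd
    refine h β hβ ((Derivable.negI hd).cut_set ?_)
    rintro _ ⟨α, hα, rfl⟩
    exact hα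
  obtain ⟨u, hu⟩ := exists_of_consistent.{v} hcons
  exact ⟨u, fun α hα => hu (.inl hα), fun α hα => hu (.inr hα)⟩

theorem dia_mem_iff : α.dia ∈ w ↔ ∃ u : World.{v} P, w.Rel u ∧ α ∈ u := by
  refine ⟨fun h => ?_, fun ⟨u, hwu, hu⟩ => dia_mem_of_rel hwu hu⟩
  obtain ⟨u, hwu, hu⟩ := exists_rel_of_derivable (w := w) (Θ := {ofML α}) (by
    intro β hβ hd
    have : (ML.box β).neg ∈ w := mem_of_derivable (.boxDiaInter (.diaMon hd (assumption h)))
    exact neg_mem_iff.1 this hβ)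
  exact ⟨u, hwu, hu α (.assumption rfl)⟩

theorem box_mem_iff : α.box ∈ w ↔ ∀ u : World.{v} P, w.Rel u → α ∈ u := by
  refine ⟨fun h u hwu => hwu α h, fun h => ?_⟩
  by_contra hn
  have : (ML.dia α.neg) ∈ w :=
    mem_of_derivable (.diaBoxInter (assumption (neg_mem_iff.2 hn)))
  obtain ⟨u, hwu, hu⟩ := dia_mem_iff.1 this
  exact neg_mem_iff.1 hu (h u hwu)

end World

/-- The canonical model of classical modal logic. -/
abbrev canonicalModel (P : Type) : KripkeModel.{v} P where
  W := World.{v} P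
  R := World.Rel
  V p := {w | .var p ∈ w}

open World in
/-- The truth lemma for classical formulas. -/
theorem ML.sat_canonicalModel {P : Type} {T : Set (World.{v} P)} {α : ML P} :
    ML.Sat (canonicalModel.{v} P) T α ↔ ∀ w ∈ T, α ∈ w := by
  rw [ML.sat_iff_forall (M := canonicalModel.{v} P)]
  refine forall₂_congr fun w hw => ?_
  clear hw
  induction α generalizing w with
  | var p => exact Set.singleton_subset_iff
  | bot => simpa [ML.Sat] using bot_notMem
  | neg α ih => rw [ML.sat_neg_iff, ih, neg_mem_iff]
  | or α β i j =>
    rw [or_mem_iff, ← i, ← j]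
    constructor
    · rintro ⟨T₁, T₂, hT, h₁, h₂⟩
      rcases (hT ▸ rfl : w ∈ T₁ ∪ T₂) with hw | hw
      exacts [.inl (ML.sat_iff_forall.1 h₁ w hw), .inr (ML.sat_iff_forall.1 h₂ w hw)]
    · rintro (h | h)
      exacts [⟨{w}, ∅, Set.union_empty _, h, ML.sat_empty _⟩,
        ⟨∅, {w}, Set.empty_union _, ML.sat_empty _, h⟩]
  | and α β i j => rw [and_mem_iff, ← i, ← j]; rfl
  | dia α ih =>
    rw [ML.sat_singleton_dia_iff, dia_mem_iff]
    exact exists_congr fun u => and_congr Iff.rfl (ih u)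
  | box α ih =>
    rw [ML.sat_singleton_box_iff, box_mem_iff]
    exact forall_congr' fun u => imp_congr Iff.rfl (ih u)

theorem ML.sat_canonicalModel_singleton {P : Type} {w : World.{v} P} {α : ML P} :
    ML.Sat (canonicalModel.{v} P) {w} α ↔ α ∈ w := by
  simp [ML.sat_canonicalModel]

/-! ### Prime theories -/

/-- A deductively closed set of formulas that decides each disjunction whose left disjunct is a
primitive inclusion atom. -/
structure IsPrimeTheory {P : Type} (Γ : Set (MLI P)) : Prop where
  mem_of_derivable {φ : MLI P} : Derivable Γ φ → φ ∈ Γ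
  mem_or_mem {n : ℕ} {x : Fin (n + 1) → Bool} {a : Fin (n + 1) → ML P} {ψ : MLI P} :
    MLI.or (MLI.prim x a) ψ ∈ Γ → MLI.prim x a ∈ Γ ∨ ψ ∈ Γ

/-- A set of formulas that derives no member of a family `I` extends to a prime theory with the same
property, if any two members of `I` have a common consequence in `I`. -/
theorem exists_isPrimeTheory {P : Type} {Γ I : Set (MLI P)}
    (hI : ∀ χ₁ ∈ I, ∀ χ₂ ∈ I, ∃ χ ∈ I, Derivable {χ₁} χ ∧ Derivable {χ₂} χ)
    (hΓ : ∀ χ ∈ I, ¬ Derivable Γ χ) :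
    ∃ Δ, Γ ⊆ Δ ∧ IsPrimeTheory Δ ∧ ∀ χ ∈ I, ¬ Derivable Δ χ := by
  have hfc : Order.IsOfFiniteCharacter {Γ : Set (MLI P) | ∀ χ ∈ I, ¬ Derivable Γ χ} := by
    refine fun Γ => ⟨fun h F hF _ χ hχ hd => h χ hχ (hd.mono hF), fun h χ hχ hd => ?_⟩
    obtain ⟨F, hF, hfin, hd⟩ := hd.exists_finite
    exact h F hF hfin χ hχ hd
  obtain ⟨Δ, hΓΔ, hΔ⟩ := hfc.exists_maximal hΓ
  have key : ∀ φ ∉ Δ, ∃ χ ∈ I, Derivable (insert φ Δ) χ := by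
    intro φ hφ
    by_contra! hn
    exact hφ (hΔ.le_of_ge hn (Set.subset_insert _ _) (Set.mem_insert _ _))
  refine ⟨Δ, hΓΔ, ⟨fun {φ} hφ => ?_, fun {n x a ψ} h => ?_⟩, hΔ.prop⟩
  · by_contra hn
    obtain ⟨χ, hχ, hd⟩ := key φ hn
    exact hΔ.prop χ hχ (hφ.cut hd)
  · by_contra! hn
    obtain ⟨χ₁, hχ₁, hd₁⟩ := key _ hn.1
    obtain ⟨χ₂, hχ₂, hd₂⟩ := key _ hn.2
    obtain ⟨χ, hχ, h₁, h₂⟩ := hI χ₁ hχ₁ χ₂ hχ₂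
    exact hΔ.prop χ hχ (.orInclE (.assumption h) (hd₁.trans h₁) (hd₂.trans h₂))

/-! ### The team of a set of formulas -/

section

open MLI

variable {P : Type}

/-- The worlds of the canonical model that contain all classical consequences of `Δ`. -/
def teamOf (Δ : Set (MLI P)) : Set (World.{v} P) := {w | ∀ α, Derivable Δ (ofML α) → α ∈ w}

theorem exists_mem_teamOf {Δ : Set (MLI P)} {α : ML P} (h : ¬ Derivable Δ (.neg α)) :
    ∃ w ∈ teamOf.{v} Δ, α ∈ w := by
  have hcons : ¬ Derivable (ofML '' insert α {γ | Derivable Δ (ofML γ)}) .bot := by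
    rw [Set.image_insert_eq, ← classicalPart_image]
    refine fun hd => h ((Derivable.negI hd).cut_set ?_)
    rintro _ ⟨γ, hγ, rfl⟩
    exact hγ
  obtain ⟨w, hw⟩ := World.exists_of_consistent.{v} hcons
  exact ⟨w, fun γ hγ => hw (.inr hγ), hw (.inl rfl)⟩

/-- Every world in the team of `Δ` belongs to the team of a prime theory extending `Δ`. -/
theorem exists_isPrimeTheory_mem_teamOf {Δ : Set (MLI P)} {w : World.{v} P} (hw : w ∈ teamOf Δ) :
    ∃ Γ, Δ ⊆ Γ ∧ IsPrimeTheory Γ ∧ w ∈ teamOf Γ := by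
  obtain ⟨Γ, hΔ, hΓ, h⟩ := exists_isPrimeTheory (Γ := Δ) (I := {χ | ∃ α ∈ w, χ = .neg α}) (by
    rintro _ ⟨α, hα, rfl⟩ _ ⟨β, hβ, rfl⟩
    exact ⟨_, ⟨_, World.and_mem_iff.2 ⟨hα, hβ⟩, rfl⟩,
      .neg_mono (.assumption rfl) (.andEl (.assumption rfl)),
      .neg_mono (.assumption rfl) (.andEr (.assumption rfl))⟩) (by
    rintro _ ⟨α, hα, rfl⟩ hd
    exact World.neg_mem_iff.1 (hw α.neg hd) hα)
  refine ⟨Γ, hΔ, hΓ, fun α hα => ?_⟩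
  by_contra hn
  exact h _ ⟨_, World.neg_mem_iff.2 hn, rfl⟩ hα.neg_neg_intro

theorem teamOf_anti {Γ Δ : Set (MLI P)} (h : ∀ γ ∈ Γ, Derivable Δ γ) :
    teamOf.{v} Δ ⊆ teamOf Γ := fun _ hw α hα => hw α (hα.cut_set h)

theorem exists_mem_teamOf_of_prim {Δ : Set (MLI P)} {n : ℕ} {x : Fin (n + 1) → Bool}
    {a : Fin (n + 1) → ML P} (h : Derivable Δ (prim x a)) (hne : (teamOf.{v} Δ).Nonempty) :
    ∃ w ∈ teamOf.{v} Δ, ML.pow a x ∈ w := by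
  refine exists_mem_teamOf fun hn => ?_
  obtain ⟨w, hw⟩ := hne
  exact World.bot_notMem (hw .bot (.inclNegE hn h))

theorem image_teamOf (Δ : Set (MLI P)) :
    (canonicalModel.{v} P).image (teamOf Δ) = teamOf {φ | Derivable Δ (.box φ)} := by
  ext u
  constructor
  · rintro ⟨w, hw, hwu⟩ α hα
    exact hwu α (hw (.box α) (.box_of_derivable hα))
  · intro hu
    -- It suffices to find `w` in the team of `Δ` with `◇α ∈ w` for all `α ∈ u`.
    have hcons : ¬ Derivable (ofML '' ({γ | Derivable Δ (ofML γ)} ∪ ML.dia '' u.carrier)) .bot := by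
      rw [Set.image_union]
      intro hd
      obtain ⟨_, ⟨_, ⟨α, hα, rfl⟩, rfl⟩, hd⟩ := Derivable.exists_of_directed
        (B := ofML '' (ML.dia '' u.carrier))
        ⟨_, _, ⟨.top, World.mem_of_derivable (.negI .hyp), rfl⟩, rfl⟩ (by
          rintro _ ⟨_, ⟨α, hα, rfl⟩, rfl⟩ _ ⟨_, ⟨β, hβ, rfl⟩, rfl⟩
          exact ⟨_, ⟨_, ⟨α.and β, World.and_mem_iff.2 ⟨hα, hβ⟩, rfl⟩, rfl⟩,
            .diaMon (.andEl (.assumption rfl)) (.assumption rfl),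
            .diaMon (.andEr (.assumption rfl)) (.assumption rfl)⟩) hd
      rw [← classicalPart_image] at hd
      have : Derivable Δ (.neg (.dia α)) := (Derivable.negI hd).cut_set (by
        rintro _ ⟨γ, hγ, rfl⟩
        exact hγ)
      exact World.neg_mem_iff.1 (hu α.neg (.assumption this.box_neg_of_neg_dia)) hα
    obtain ⟨w, hw⟩ := World.exists_of_consistent.{v} hcons
    refine ⟨w, fun γ hγ => hw (.inl hγ), fun β hβ => ?_⟩
    by_contra hn
    have h₁ : (ML.dia β.neg) ∈ w := hw (.inr ⟨_, World.neg_mem_iff.2 hn, rfl⟩)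
    have h₂ : (ML.box β).neg ∈ w := World.mem_of_derivable (.boxDiaInter (World.assumption h₁))
    exact World.neg_mem_iff.1 h₂ hβ

/-- The team of a set of formulas satisfies the consequences of that set. -/
theorem sat_teamOf {φ : MLI P} {Δ : Set (MLI P)} (h : Derivable Δ φ) :
    Sat (canonicalModel.{v} P) (teamOf Δ) φ := by
  induction φ generalizing Δ with
  | var p => exact fun w hw => hw (.var p) h
  | bot => exact Set.eq_empty_of_forall_notMem fun w hw => World.bot_notMem (hw .bot h)
  | incl n a b =>
    classical
    intro w hw
    obtain ⟨Γ, hΔ, hΓ, hw'⟩ := exists_isPrimeTheory_mem_teamOf hw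
    -- `x` lists the truth values of `a` at `w`.
    set x : Fin (n + 1) → Bool := fun i => decide (a i ∈ w)
    have hax : ML.pow a x ∈ w := World.pow_mem_iff.2 fun i => decide_eq_true_iff
    have hor : MLI.or (prim x b) (.neg (ML.pow a x)) ∈ Γ :=
      hΓ.mem_of_derivable (.or_comm (.inclRdt (h.mono hΔ)))
    have hprim : Derivable Γ (prim x b) :=
      .assumption ((hΓ.mem_or_mem hor).resolve_right fun hn =>
        World.neg_mem_iff.1 (hw' (ML.pow a x).neg (.assumption hn)) hax)
    obtain ⟨u, hu, hbu⟩ := exists_mem_teamOf_of_prim hprim ⟨w, hw'⟩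
    refine ⟨u, teamOf_anti (fun γ hγ => .assumption (hΔ hγ)) hu, fun i => ?_⟩
    rw [ML.sat_canonicalModel_singleton, ML.sat_canonicalModel_singleton,
      ← World.pow_mem_iff.1 hax i, ← World.pow_mem_iff.1 hbu i]
  | neg α =>
    intro w hw hα
    exact World.neg_mem_iff.1 (hw α.neg h) (ML.sat_canonicalModel_singleton.1 hα)
  | or φ ψ i j =>
    -- Each disjunct gets the worlds that contain its consequences modulo `Θ`. A world of neither kind
    -- refutes some consequence `α` of `φ` and some `β` of `ψ`, although `Δ` derives `α ∨ β`.
    set Θ := classicalPart {γ | Derivable Δ γ}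
    have hΘΔ : ∀ γ ∈ Θ, Derivable Δ γ := fun γ hγ => hγ.1
    have hsub : ∀ χ : MLI P, teamOf.{v} (insert χ Θ) ⊆ teamOf Δ := fun χ w hw α hα =>
      hw α (.assumption (.inr ⟨hα, isClassical_ofML α⟩))
    refine ⟨teamOf (insert φ Θ), teamOf (insert ψ Θ), ?_, i .hyp, j .hyp⟩
    refine (Set.union_subset (hsub φ) (hsub ψ)).antisymm fun w hw => ?_
    by_contra hn
    rw [Set.mem_union, not_or] at hn
    simp only [teamOf, Set.mem_ofPred_eq] at hn
    push Not at hn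
    obtain ⟨⟨α, hα, hαw⟩, β, hβ, hβw⟩ := hn
    have hor : Derivable Δ (ofML (α.or β)) := by
      refine Derivable.cut_set (Δ := insert (.or φ ψ) Θ) (.orE .hyp ?_ ?_) ?_
      · exact .orIl (hα.mono (Set.insert_subset_insert fun γ hγ => ⟨.inr hγ, hγ.2⟩))
      · exact .orIr (hβ.mono (Set.insert_subset_insert fun γ hγ => ⟨.inr hγ, hγ.2⟩))
      · rintro γ (rfl | hγ)
        exacts [h, hΘΔ γ hγ]
    exact (World.or_mem_iff.1 (hw _ hor)).elim hαw hβw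
  | and φ ψ i j => exact ⟨i h.andEl, j h.andEr⟩
  | dia φ i =>
    -- `φ` is evaluated together with the necessary classical formulas `N`. Each world of the team sees
    -- a world of the resulting team, because `◇(φ ∧ γ)` is derivable for each `γ ∈ N`.
    set N : Set (MLI P) := ofML '' {γ | Derivable Δ (.box (ofML γ))}
    refine ⟨teamOf (insert φ N), ⟨?_, fun w hw => ?_⟩, i .hyp⟩
    · rw [image_teamOf]
      exact fun u hu α hα => hu α (.assumption (.inr ⟨α, .box_of_derivable hα, rfl⟩))
    · obtain ⟨u, hwu, hu⟩ := World.exists_rel_of_derivable (w := w) (Θ := insert φ N) (by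
        intro β hβ hd
        rw [← Set.singleton_union] at hd
        obtain ⟨_, ⟨γ, hγ, rfl⟩, hd⟩ := Derivable.exists_of_directed (B := N)
          ⟨_, .top, .box_of_derivable (.negI .hyp), rfl⟩ (by
            rintro _ ⟨γ, hγ, rfl⟩ _ ⟨δ, hδ, rfl⟩
            exact ⟨_, ⟨γ.and δ, .box_of_derivable (.andI (.assumption hγ) (.assumption hδ)), rfl⟩,
              .andEl (.assumption rfl), .andEr (.assumption rfl)⟩) hd
        have hneg : Derivable Δ (.neg (.box β)) := by
          refine .boxDiaInter (.diaMon (hd.cut_set ?_) (h.dia_and_of_box hγ))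
          rintro _ (rfl | rfl)
          exacts [.andEr (.assumption rfl), .andEl (.assumption rfl)]
        exact World.neg_mem_iff.1 (hw (ML.box β).neg hneg) hβ)
      exact ⟨u, hu, hwu⟩
  | box φ i =>
    simp only [Sat]
    rw [image_teamOf]
    exact i (.assumption h)

/-! ### The diagram of a team -/

/-- What classical formulas say about a team of the canonical model: `α` if it is true throughout the
team, and `⊤ ⊆ α` if it is true at some world of the team. -/
def diagram (T : Set (World.{v} P)) : Set (MLI P) :=
  ofML '' {α | ∀ w ∈ T, α ∈ w} ∪ prim₁ true '' {α | ∃ w ∈ T, α ∈ w}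

theorem derivable_diagram {T : Set (World.{v} P)} {α : ML P} (h : ∀ w ∈ T, α ∈ w) :
    Derivable (diagram T) (ofML α) := .assumption (.inl ⟨α, h, rfl⟩)

theorem derivable_diagram_prim₁ {T : Set (World.{v} P)} {α : ML P} (h : ∃ w ∈ T, α ∈ w) :
    Derivable (diagram T) (prim₁ true α) := .assumption (.inr ⟨α, h, rfl⟩)

/-- A consequence of the diagram follows from a finite part, which may be taken to consist of one
formula `α` true throughout the team and of realised formulas that imply `α`. -/
theorem exists_of_derivable_diagram {T : Set (World.{v} P)} {φ : MLI P}
    (h : Derivable (diagram T) φ) :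
    ∃ (α : ML P) (l : List (ML P)), (∀ w ∈ T, α ∈ w) ∧ (∀ β ∈ l, ∃ w ∈ T, β ∈ w) ∧
      (∀ β ∈ l, Derivable {ofML β} (ofML α)) ∧
      Derivable (insert (ofML α) {ψ | ∃ β ∈ l, ψ = prim₁ true β}) φ := by
  obtain ⟨F, hF, hfin, h⟩ := h.exists_finite
  have key : ∃ (α : ML P) (l : List (ML P)), (∀ w ∈ T, α ∈ w) ∧ (∀ β ∈ l, ∃ w ∈ T, β ∈ w) ∧
      ∀ γ ∈ F, Derivable (insert (ofML α) {ψ | ∃ β ∈ l, ψ = prim₁ true β}) γ := by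
    clear h
    induction F, hfin using Set.Finite.induction_on with
    | empty =>
      exact ⟨.top, [], fun w _ => World.mem_of_derivable (.negI .hyp), by simp, by simp⟩
    | @insert δ F _ _ ih =>
      rw [Set.insert_subset_iff] at hF
      obtain ⟨α, l, hα, hl, hd⟩ := ih hF.2
      rcases hF.1 with ⟨β, hβ, rfl⟩ | ⟨β, hβ, rfl⟩
      · refine ⟨α.and β, l, fun w hw => World.and_mem_iff.2 ⟨hα w hw, hβ w hw⟩, hl, ?_⟩
        rintro γ (rfl | hγ)
        · exact .andEr (φ := ofML α) .hyp
        · refine (hd γ hγ).cut_set ?_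
          rintro δ (rfl | hδ)
          exacts [.andEl (ψ := ofML β) .hyp, .assumption (.inr hδ)]
      · refine ⟨α, β :: l, hα, ?_, ?_⟩
        · rintro γ hγ
          rcases List.mem_cons.1 hγ with rfl | hγ
          exacts [hβ, hl γ hγ]
        · rintro γ (rfl | hγ)
          · exact .assumption (.inr ⟨β, by simp, rfl⟩)
          · refine (hd γ hγ).mono (Set.insert_subset_insert ?_)
            rintro _ ⟨δ, hδ, rfl⟩
            exact ⟨δ, by simp [hδ], rfl⟩
  obtain ⟨α, l, hα, hl, hd⟩ := key
  refine ⟨α, l.map fun β => β.and α, hα, ?_, ?_, (h.cut_set hd).cut_set ?_⟩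
  · intro γ hγ
    obtain ⟨β, hβ, rfl⟩ := List.mem_map.1 hγ
    exact (hl β hβ).imp fun w hw => ⟨hw.1, World.and_mem_iff.2 ⟨hw.2, hα w hw.1⟩⟩
  · intro γ hγ
    obtain ⟨β, hβ, rfl⟩ := List.mem_map.1 hγ
    exact .andEr (.assumption rfl)
  · rintro _ (rfl | ⟨β, hβ, rfl⟩)
    · exact .hyp
    · exact .prim₁_mono (.assumption (.inr ⟨_, List.mem_map.2 ⟨β, hβ, rfl⟩, rfl⟩))
        (.andEl (.assumption rfl))

/-- The diagram of a team derives every formula, classical or not, that the team satisfies. -/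
theorem derivable_diagram_of_sat {φ : MLI P} {T : Set (World.{v} P)}
    (h : Sat (canonicalModel.{v} P) T φ) : Derivable (diagram T) φ := by
  induction φ generalizing T with
  | var p => exact derivable_diagram (α := .var p) h
  | bot =>
    obtain rfl : T = ∅ := h
    exact derivable_diagram (α := .bot) (by simp)
  | incl n a b =>
    refine .inclExt (.cubeConj_intro fun x => ?_)
    by_cases hx : ∃ u ∈ T, ML.pow b x ∈ u
    · exact .orIr (.prim_of_pow (derivable_diagram_prim₁ hx))
    · refine .orIl (derivable_diagram (α := (ML.pow a x).neg) fun w hw => ?_)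
      rw [World.neg_mem_iff]
      intro hax
      obtain ⟨u, hu, hwu⟩ := h w hw
      refine hx ⟨u, hu, World.pow_mem_iff.2 fun i => ?_⟩
      have := hwu i
      rw [ML.sat_canonicalModel_singleton, ML.sat_canonicalModel_singleton] at this
      rw [World.pow_mem_iff.1 hax i, this]
  | neg α =>
    refine derivable_diagram (α := α.neg) fun w hw => World.neg_mem_iff.2 fun hα => h w hw ?_
    exact ML.sat_canonicalModel_singleton.2 hα
  | or φ ψ i j =>
    obtain ⟨T₁, T₂, rfl, h₁, h₂⟩ := h
    obtain ⟨α₁, l₁, hα₁, hl₁, hi₁, hd₁⟩ := exists_of_derivable_diagram (i h₁)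
    obtain ⟨α₂, l₂, hα₂, hl₂, hi₂, hd₂⟩ := exists_of_derivable_diagram (j h₂)
    have hor : Derivable (diagram (T₁ ∪ T₂)) (.or (ofML α₁) (ofML α₂)) :=
      derivable_diagram (α := α₁.or α₂) fun w hw =>
        World.or_mem_iff.2 (hw.imp (hα₁ w) (hα₂ w))
    refine .or_comm (.or_of_prim₁ (.or_comm (.or_of_prim₁ hor ?_ hi₁ hd₁)) ?_ hi₂ hd₂)
    · exact fun β hβ => derivable_diagram_prim₁ ((hl₁ β hβ).imp fun w hw => ⟨.inl hw.1, hw.2⟩)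
    · exact fun β hβ => derivable_diagram_prim₁ ((hl₂ β hβ).imp fun w hw => ⟨.inr hw.1, hw.2⟩)
  | and φ ψ i j => exact .andI (i h.1) (j h.2)
  | dia φ i =>
    obtain ⟨S, ⟨h₁, h₂⟩, hS⟩ := h
    obtain ⟨α, l, hα, hl, hi, hd⟩ := exists_of_derivable_diagram (i hS)
    refine .dia_of_prim₁ (α := α) (derivable_diagram (α := .dia α) fun w hw => ?_) ?_ hi hd
    · obtain ⟨u, hu, hwu⟩ := h₂ hw
      exact World.dia_mem_of_rel hwu (hα u hu)
    · intro β hβ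
      obtain ⟨u, hu, hβu⟩ := hl β hβ
      obtain ⟨w, hw, hwu⟩ := h₁ hu
      exact derivable_diagram_prim₁ ⟨w, hw, World.dia_mem_of_rel hwu hβu⟩
  | box φ i =>
    refine .box_of_derivable ((i h).mono ?_)
    rintro _ (⟨α, hα, rfl⟩ | ⟨α, ⟨u, ⟨w, hw, hwu⟩, hu⟩, rfl⟩)
    · exact derivable_diagram (α := .box α) fun w hw =>
        World.box_mem_iff.2 fun u hwu => hα u ⟨w, hw, hwu⟩
    · exact .box_prim₁ (derivable_diagram_prim₁ ⟨w, hw, World.dia_mem_of_rel hwu hu⟩)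

/-- A prime theory derives the diagram of its team. -/
theorem IsPrimeTheory.derivable_of_mem_diagram {Γ : Set (MLI P)} (hΓ : IsPrimeTheory Γ) {δ : MLI P}
    (hδ : δ ∈ diagram (teamOf.{v} Γ)) : Derivable Γ δ := by
  have dich : ∀ α : ML P, prim₁ true α ∈ Γ ∨ MLI.neg α ∈ Γ := fun α =>
    hΓ.mem_or_mem (hΓ.mem_of_derivable (.prim_or_neg (fun _ => true) fun _ : Fin 1 => α))
  rcases hδ with ⟨α, hα, rfl⟩ | ⟨α, ⟨w, hw, hαw⟩, rfl⟩
  · by_contra hn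
    obtain ⟨w, hw, hαw⟩ := exists_mem_teamOf.{v} (Δ := Γ) (α := α.neg) fun h => hn h.of_neg_neg
    exact World.neg_mem_iff.1 hαw (hα w hw)
  · exact .assumption ((dich α).resolve_right fun hn =>
      World.neg_mem_iff.1 (hw α.neg (.assumption hn)) hαw)

theorem Derivable.complete {Γ : Set (MLI P)} {ψ : MLI P} (h : Entails.{v} Γ ψ) :
    Derivable Γ ψ := by
  by_contra hn
  obtain ⟨Δ, hΓΔ, hΔ, hψ⟩ := exists_isPrimeTheory (Γ := Γ) (I := {ψ})
    (by rintro _ rfl _ rfl; exact ⟨_, rfl, .assumption rfl, .assumption rfl⟩)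
    (by rintro _ rfl; exact hn)
  have hsat := h (canonicalModel.{v} P) (teamOf Δ) fun γ hγ => sat_teamOf (.assumption (hΓΔ hγ))
  exact hψ ψ rfl ((derivable_diagram_of_sat hsat).cut_set fun δ hδ =>
    hΔ.derivable_of_mem_diagram hδ)

end

theorem mainTheorem1 {P : Type} [Countable P] [Infinite P] (Γ : Set (MLI P)) (ψ : MLI P) :
    (MLI.Entails.{v} Γ ψ → Derivable Γ ψ) ∧ (Derivable Γ ψ → MLI.Entails.{v} Γ ψ) :=
  ⟨Derivable.complete, Derivable.sound⟩
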